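/- Throughout, graphs are finite and simple, $s,t\ge 1$ are integers, $K_{s,t}$ is the complete bipartite graph with parts of sizes $s$ and $t$, $\delta(G)$ is the minimum degree of $G$, and $N(K_{s,t},G)$ is the number of (not necessarily induced) subgraphs of $G$ isomorphic to $K_{s,t}$. For positive integers $m\ge \ell$ and $a$ put $$g_{s,t}(m,\ell,a)=\sum_{i=1}^{m-\ell+a}\binom{a}{s}\binom{m-s-i}{s-1}+\frac12\binom{\ell-a}{2s}\binom{2s}{s}\qquad\text{if } s=t,$$ $$g_{s,t}(m,\ell,a)=\sum_{i=1}^{m-\ell+a}\left(\binom{a}{s}\binom{m-s-i}{t-1}+\binom{a}{t}\binom{m-t-i}{s-1}\right)+\binom{\ell-a}{s+t}\binom{s+t}{s}\qquad\text{if } s\ne t,$$ where a negative upper entry of a binomial coefficient is read as $0$ (for $1\le a<\ell/2$ this convention is immaterial, because every summand with a negative upper entry $m-s-i$ or $m-t-i$ also has a vanishing factor $\binom as$ or $\binom at$, respectively). For $1\le a<\ell/2$ and $\ell\le m$ let $H_{m,\ell,a}$ be the graph on $m$ vertices whose vertex set is the disjoint union of sets $A,B,C$ with $|A|=a$, $|B|=m-\ell+a$,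 $|C|=\ell-2a$, and whose edges are all edges between $A$ and $B$ and all edges inside $A\cup C$. **Theorem 2.5.** Let $n\ge k\ge 4$, $r\ge 1$ and $h=\lfloor (k-2)/2\rfloor$. (1) If $G$ is a connected graph on $n$ vertices with $\delta(G)\ge r$ and $$N(K_{s,t},G)>\max\{g_{s,t}(n,k-1,r),\,g_{s,t}(n,k-1,h)\},$$ then $G$ contains a path on $k$ vertices. (2) The bound is sharp, with extremal graphs $H_{n,k-1,r}$ and $H_{n,k-1,h}$: if $r\le h$ (that is, $r<(k-1)/2$), then for each $a\in\{r,h\}$ the graph $H_{n,k-1,a}$ is a connected graph on $n$ vertices with $\delta(H_{n,k-1,a})\ge r$ and $N(K_{s,t},H_{n,k-1,a})=g_{s,t}(n,k-1,a)$, and it contains no path on $k$ vertices. -/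

import Mathlib

/-- The extremal function `g_{s,t}(n,k,a)`. In the relevant range `1 ≤ a`, `2 * a < k ≤ n` no
truncation matters: a summand whose factor `C(a,s)` (resp. `C(a,t)`) does not vanish has
`n - s - i > 0` (resp. `n - t - i > 0`). For `s ≥ 1` the number `C(2s,s)` is even, so the division
by two is exact. -/
def gFun (s t n k a : ℕ) : ℕ :=
  if s = t then
    (∑ i ∈ Finset.Icc 1 (n - k + a), a.choose s * (n - s - i).choose (s - 1))
      + (k - a).choose (2 * s) * (2 * s).choose s / 2
  else
    (∑ i ∈ Finset.Icc 1 (n - k + a),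
        (a.choose s * (n - s - i).choose (t - 1) + a.choose t * (n - t - i).choose (s - 1)))
      + (k - a).choose (s + t) * (s + t).choose s

/-- The graph `H_{n,k,a}` (for `1 ≤ a`, `2 * a < k ≤ n`). The three summands of the vertex type
are the sets `A`, `B`, `C` with `|A| = a`, `|B| = n - k + a`, `|C| = k - 2 * a`; the edges are all
edges between `A` and `B` and all edges inside `A ∪ C`. `SimpleGraph.fromRel` symmetrizes the
relation and removes loops. -/
def extremalGraph (n k a : ℕ) : SimpleGraph (Fin a ⊕ Fin (n - k + a) ⊕ Fin (k - 2 * a)) :=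
  SimpleGraph.fromRel fun x y =>
    match x, y with
    | .inl _, .inr (.inl _) => True
    | .inl _, .inl _ => True
    | .inl _, .inr (.inr _) => True
    | .inr (.inr _), .inr (.inr _) => True
    | _, _ => False

noncomputable instance extremalGraph.instDecidableRelAdj (n k a : ℕ) :
    DecidableRel (extremalGraph n k a).Adj :=
  Classical.decRel _

/-! Upper bound. Add edges to a counterexample until every further edge creates a path on `k`
vertices; connectivity and the degree condition survive, and the number of copies does not drop. If
`x`, `y` are then nonadjacent, removing the edge `xy` from a long path of `G + xy` leaves two
disjoint paths starting in `x` and `y` with at least `k` vertices in total. Kopylov's lemma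
(`exists_long_path_of_countP`) turns these into a path on `k` vertices of `G` once the degrees of
`x` and `y` into the two paths sum to at least `k - 1`. Hence vertices of sets with inner degrees at
least `p` and `q`, where `p + q ≥ k - 1`, are adjacent (`IsPathSaturated.adj_of_inner_degree`).

Let `h = (k - 2) / 2` and let `H` be the largest set with inner degrees above `h`; it is a clique.
If `|H| ≤ k - 1 - h`, deleting vertices of degree at most `h` down to `k - 1 - h` vertices gives the
bound at `h`. Otherwise put `|H| = k - 1 - α`. By the adjacency criterion a vertex of the `α`-core
is joined to all of `H`, hence lies in `H`. So the two cores agree and vertices of degree at most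
`α` can be deleted down to `H`, which gives the bound at `α`. Since `r ≤ α ≤ h` and the bound is
convex in its degree parameter (`two_mul_bicliqueBound_le`), the value at `r` or at `h` dominates.

The count is made for ordered pairs of sides, which is twice the number of copies if `s = t`.
Deleting a vertex of degree `d` from `m + 1` vertices destroys at most `C(d,s) C(m-s,t-1) + C(d,t)
C(m-t,s-1)` pairs. Equality holds if all neighbours are adjacent to everything else, so building
`H_{n,k-1,a}` from the clique `A ∪ C` by adding the vertices of `B` attains the bound. It has no
path on `k` vertices because the vertices of `B` on a path must be separated by vertices of `A`. -/

open SimpleGraph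

/-! ### Paths as vertex lists -/

/-- A list of vertices which traverses a path of `G`. -/
def IsPathList {V : Type*} (G : SimpleGraph V) (l : List V) : Prop :=
  l.IsChain G.Adj ∧ l.Nodup

theorem isChain_adj_reverse {V : Type*} {G : SimpleGraph V} {l : List V}
    (h : l.IsChain G.Adj) : l.reverse.IsChain G.Adj := by
  rw [List.isChain_reverse]
  exact h.imp fun a b hab => hab.symm

theorem IsPathList.reverse {V : Type*} {G : SimpleGraph V} {l : List V}
    (h : IsPathList G l) : IsPathList G l.reverse :=
  ⟨isChain_adj_reverse h.1, List.nodup_reverse.2 h.2⟩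

theorem IsPathList.infix {V : Type*} {G : SimpleGraph V} {l l' : List V}
    (h : IsPathList G l) (h' : l' <:+: l) : IsPathList G l' :=
  ⟨h.1.infix h', h.2.sublist h'.sublist⟩

theorem pathGraph_isContained_of_isPathList {V : Type*} {G : SimpleGraph V} {l : List V} {k : ℕ}
    (h : IsPathList G l) (hk : k ≤ l.length) : (pathGraph k).IsContained G := by
  have hchain := List.isChain_iff_getElem.1 h.1
  refine ⟨⟨⟨fun i : Fin k => l[i.1]'(i.2.trans_le hk), ?_⟩, ?_⟩⟩
  · intro a b hab
    rw [pathGraph_adj] at hab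
    rcases hab with hab | hab
    · have := hchain a.1 (by have := b.2; omega)
      simpa [hab] using this
    · have := hchain b.1 (by have := a.2; omega)
      simpa [hab] using this.symm
  · intro a b hab
    have := (List.Nodup.getElem_inj_iff h.2).1 hab
    exact Fin.ext this

theorem exists_isPathList_of_pathGraph_isContained {V : Type*} {G : SimpleGraph V} {k : ℕ}
    (h : (pathGraph k).IsContained G) : ∃ l, IsPathList G l ∧ l.length = k := by
  obtain ⟨f⟩ := h
  refine ⟨List.ofFn f, ⟨?_, ?_⟩, by simp⟩
  · rw [List.isChain_iff_getElem]
    intro i hi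
    simp only [List.length_ofFn] at hi
    simp only [List.getElem_ofFn]
    apply f.toHom.map_rel
    rw [pathGraph_adj]
    simp
  · exact List.nodup_ofFn.2 f.injective

theorem List.exists_first_split {α : Type*} (p : α → Prop) (l : List α) (h : ∃ x ∈ l, p x) :
    ∃ l₁ x l₂, l = l₁ ++ x :: l₂ ∧ p x ∧ ∀ y ∈ l₁, ¬ p y := by
  induction l with
  | nil => simp at h
  | cons a l ih =>
    by_cases ha : p a
    · exact ⟨[], a, l, rfl, ha, by simp⟩
    · obtain ⟨l₁, x, l₂, rfl, hx, hl⟩ := ih (by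
        obtain ⟨x, hx, hpx⟩ := h
        rcases List.mem_cons.1 hx with rfl | hx
        · exact absurd hpx ha
        · exact ⟨x, hx, hpx⟩)
      exact ⟨a :: l₁, x, l₂, rfl, hx, by simpa [ha] using hl⟩

theorem List.exists_last_split {α : Type*} (p : α → Prop) (l : List α) (h : ∃ x ∈ l, p x) :
    ∃ l₁ x l₂, l = l₁ ++ x :: l₂ ∧ p x ∧ ∀ y ∈ l₂, ¬ p y := by
  obtain ⟨l₁, x, l₂, hl, hx, hp⟩ := List.exists_first_split p l.reverse (by simpa using h)
  refine ⟨l₂.reverse, x, l₁.reverse, ?_, hx, by simpa using hp⟩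
  have := congrArg List.reverse hl
  simpa using this

/-- In a connected graph any two vertex sets are joined by a path with no inner vertex in either
of them. -/
theorem exists_linking_path {V : Type*} {G : SimpleGraph V} (hG : G.Connected)
    {p q : V → Prop} (hp : ∃ x, p x) (hq : ∃ x, q x) (hpq : ∀ x, p x → ¬ q x) :
    ∃ a R b, p a ∧ q b ∧ IsPathList G (a :: (R ++ [b])) ∧ ∀ z ∈ R, ¬ p z ∧ ¬ q z := by
  obtain ⟨u, hu⟩ := hp
  obtain ⟨v, hv⟩ := hq
  obtain ⟨w, hw⟩ := (hG.preconnected u v).exists_isPath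
  have hl : IsPathList G w.support := ⟨w.isChain_adj_support, hw.support_nodup⟩
  -- Leaving at the last `p`-vertex and stopping at the first `q`-vertex after it keeps the inner
  -- vertices out of both sets.
  obtain ⟨l₁, a, l₂, hsplit, ha, hl₂⟩ :=
    List.exists_last_split p w.support ⟨u, w.start_mem_support, hu⟩
  have hv2 : ∃ x ∈ l₂, q x := by
    have hlast : (l₁ ++ a :: l₂).getLast (by simp) = v := by
      simp [← hsplit]
    have hne : l₂ ≠ [] := by
      rintro rfl
      simp at hlast
      exact hpq _ ha (hlast ▸ hv)
    refine ⟨v, ?_, hv⟩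
    rw [List.getLast_append_of_ne_nil _ (by simp), List.getLast_cons hne] at hlast
    rw [← hlast]
    exact List.getLast_mem hne
  obtain ⟨R, b, l₃, rfl, hb, hR⟩ := List.exists_first_split q l₂ hv2
  refine ⟨a, R, b, ha, hb, hl.infix ⟨l₁, l₃, by simp [hsplit]⟩, ?_⟩
  intro z hz
  exact ⟨hl₂ z (by simp [hz]), hR z hz⟩

/-! ### Kopylov's lemma for two disjoint paths -/

/-- A path starting in `x` can be rerouted, using a chord at `x`, to a path which ends in a
prescribed vertex and still contains `x` and all its neighbours. -/
theorem exists_rerouted_path {V : Type*} {G : SimpleGraph V} [DecidableRel G.Adj] {x p : V}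
    {P : List V} (hP : IsPathList G (x :: P)) (hp : p ∈ x :: P) :
    ∃ L, IsPathList G (L ++ [p]) ∧ (∀ z ∈ L, z ∈ x :: P) ∧
      (x :: P).countP (G.Adj x ·) ≤ L.length := by
  obtain ⟨P₁, P₂, hsplit⟩ := List.append_of_mem hp
  have hhead : (P₁ ++ [p]).head? = some x := by
    have := congrArg List.head? hsplit
    cases P₁ <;> simp_all
  have hcount : (P₁ ++ [p]).countP (G.Adj x ·) ≤ P₁.length := by
    obtain ⟨T, hT⟩ : ∃ T, P₁ ++ [p] = x :: T := by
      cases h : P₁ ++ [p] with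
      | nil => simp at h
      | cons a T => rw [h] at hhead; simp at hhead; exact ⟨T, by rw [hhead]⟩
    have := congrArg List.length hT
    simp at this
    rw [hT, List.countP_cons, if_neg (by simp), this]
    exact List.countP_le_length
  -- If `q` is the first neighbour of `x` beyond `p`, run from the far end back to `q`, jump to `x`
  -- and continue to `p`; only `P₃`, which has no neighbour of `x`, is skipped. Without such a `q`
  -- the initial segment up to `p` suffices.
  by_cases hnb : ∃ z ∈ P₂, G.Adj x z
  · obtain ⟨P₃, q, P₄, rfl, hq, hP₃⟩ := List.exists_first_split _ _ hnb
    refine ⟨P₄.reverse ++ q :: P₁, ⟨?_, ?_⟩, ?_, ?_⟩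
    · have h1 : (q :: P₄).reverse.IsChain G.Adj := isChain_adj_reverse
        (hP.1.infix ⟨P₁ ++ p :: P₃, [], by simp [hsplit]⟩)
      have h2 : (P₁ ++ [p]).IsChain G.Adj := hP.1.infix ⟨[], P₃ ++ q :: P₄, by simp [hsplit]⟩
      have : P₄.reverse ++ q :: P₁ ++ [p] = (q :: P₄).reverse ++ (P₁ ++ [p]) := by simp
      rw [this, List.isChain_append]
      refine ⟨h1, h2, ?_⟩
      intro a ha b hb
      rw [hhead] at hb
      simp at ha hb
      subst ha hb
      exact hq.symm
    · have := hP.2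
      rw [hsplit] at this
      refine List.Sublist.nodup (l₂ := P₄.reverse ++ q :: P₁ ++ p :: P₃)
        (by simp) ?_
      refine (List.Perm.nodup_iff ?_).1 this
      rw [← Multiset.coe_eq_coe]
      simp only [← Multiset.coe_add, ← Multiset.cons_coe, Multiset.coe_reverse,
        ← Multiset.singleton_add]
      abel
    · intro z hz
      rw [hsplit]
      simp at hz ⊢
      tauto
    · rw [hsplit]
      have h0 : P₃.countP (G.Adj x ·) = 0 := by
        rw [List.countP_eq_zero]; simpa using hP₃
      have e : P₁ ++ p :: (P₃ ++ q :: P₄) = (P₁ ++ [p]) ++ (P₃ ++ q :: P₄) := by simp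
      rw [e, List.countP_append (l₁ := P₁ ++ [p]), List.countP_append (l₁ := P₃), h0]
      have := List.countP_le_length (p := (G.Adj x ·)) (l := q :: P₄)
      simp at this ⊢
      simp at hcount
      omega
  · refine ⟨P₁, hP.infix ⟨[], P₂, by simp [hsplit]⟩, ?_, ?_⟩
    · intro z hz; rw [hsplit]; simp [hz]
    · have h0 : P₂.countP (G.Adj x ·) = 0 := by
        rw [List.countP_eq_zero]; simpa using hnb
      have e : P₁ ++ p :: P₂ = (P₁ ++ [p]) ++ P₂ := by simp
      rw [hsplit, e, List.countP_append (l₁ := P₁ ++ [p]), h0]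
      simpa using hcount

/-- The non-crossing case of the degree condition for long paths. -/
theorem exists_long_path_of_noncrossing {V : Type*} {G : SimpleGraph V} [DecidableRel G.Adj]
    (hG : G.Connected) {x y : V} {P Q : List V} (hP : IsPathList G (x :: P))
    (hQ : IsPathList G (y :: Q)) (hdisj : (x :: P).Disjoint (y :: Q)) :
    ∃ l, IsPathList G l ∧
      (x :: P).countP (G.Adj x ·) + (y :: Q).countP (G.Adj y ·) + 2 ≤ l.length := by
  obtain ⟨a, R, b, ha, hb, hR, hRd⟩ := exists_linking_path hG (p := (· ∈ x :: P))
    (q := (· ∈ y :: Q)) ⟨x, by simp⟩ ⟨y, by simp⟩ (fun z h1 h2 => hdisj h1 h2)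
  obtain ⟨L₁, h₁, hs₁, hc₁⟩ := exists_rerouted_path hP ha
  obtain ⟨L₂, h₂, hs₂, hc₂⟩ := exists_rerouted_path hQ hb
  have h₂' := h₂.reverse
  simp only [List.reverse_append, List.reverse_singleton, List.singleton_append] at h₂'
  refine ⟨L₁ ++ a :: (R ++ b :: L₂.reverse), ⟨?_, ?_⟩, ?_⟩
  · rw [List.isChain_split]
    refine ⟨h₁.1, ?_⟩
    rw [← List.cons_append, List.isChain_split]
    exact ⟨hR.1, h₂'.1⟩
  · have n1 := h₁.2
    have n2 := h₂'.2
    have n3 := hR.2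
    have hsa : ∀ z ∈ L₁ ++ [a], z ∈ x :: P := by
      intro z hz
      rcases List.mem_append.1 hz with hz | hz
      · exact hs₁ z hz
      · simp at hz; rw [hz]; exact ha
    have hsb : ∀ z ∈ b :: L₂.reverse, z ∈ y :: Q := by
      intro z hz
      rcases List.mem_cons.1 hz with hz | hz
      · rw [hz]; exact hb
      · exact hs₂ z (by simpa using hz)
    have e : L₁ ++ a :: (R ++ b :: L₂.reverse) = (L₁ ++ [a]) ++ (R ++ b :: L₂.reverse) := by simp
    rw [e, List.nodup_append']
    refine ⟨n1, ?_, ?_⟩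
    · rw [List.nodup_append']
      refine ⟨n3.sublist (by simp), n2, ?_⟩
      intro z hz hz'
      exact (hRd z hz).2 (hsb z hz')
    · intro z hz hz'
      rcases List.mem_append.1 hz' with h | h
      · exact (hRd z h).1 (hsa z hz)
      · exact hdisj (hsa z hz) (hsb z h)
  · simp only [List.length_append, List.length_cons, List.length_reverse]
    omega

/-- The successor of an element of `Y` is never in `X`, so shifting by one injects `Y` without the
last entry into the complement of `X` without the first entry. The two conditionals record these
ends. -/
theorem List.countP_add_countP_le_of_isChain {α : Type*} {X Y : α → Prop} [DecidablePred X]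
    [DecidablePred Y] (l : List α) (a : α)
    (h : (a :: l).IsChain fun u v => ¬ (Y u ∧ X v)) :
    (a :: l).countP (X ·) + (a :: l).countP (Y ·) +
      (if Y ((a :: l).getLast (by simp)) then 0 else 1) ≤
      (a :: l).length + if X a then 1 else 0 := by
  induction l generalizing a with
  | nil => simp only [List.countP_singleton, List.getLast_singleton]; split_ifs <;> simp_all
  | cons b l ih =>
    rw [List.isChain_cons_cons] at h
    have := ih b h.2
    rw [List.countP_cons (l := b :: l), List.countP_cons (l := b :: l), List.getLast_cons (by simp),
      List.length_cons (as := b :: l)]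
    have h1 := h.1
    by_cases hx : X b <;> by_cases hy : Y a <;> by_cases hxa : X a <;> simp_all <;> omega

/-- A crossing of `Y` before `X` in a list can be chosen so that the part between the two elements
misses any given element of `X` and is empty or disjoint from `X ∪ Y`, whence the outer part
has at least as many elements as `X` and `Y` together. -/
theorem List.exists_minimal_crossing {α : Type*} {X Y : α → Prop} [DecidablePred X]
    [DecidablePred Y] {Z : List α} {w : α} (hXw : X w)
    (hhead : ∀ u ∈ Z.head?, ¬ X u) (hlast : ∀ u ∈ Z.getLast?, ¬ Y u)
    (hcross : ∃ A a M b B, Z = (A ++ [a]) ++ M ++ (b :: B) ∧ Y a ∧ X b) :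
    ∃ A a M b B, Z = (A ++ [a]) ++ M ++ (b :: B) ∧ Y a ∧ X b ∧ w ∉ M ∧
      (M = [] ∨ Z.countP (X ·) + Z.countP (Y ·) ≤ (A ++ [a]).length + (b :: B).length) := by
  classical
  -- Minimise the gap `M`: an element of `X` or `Y` inside it would give a shorter crossing.
  have hex : ∃ m, ∃ A a M b B, M.length = m ∧ Z = (A ++ [a]) ++ M ++ (b :: B) ∧ Y a ∧ X b := by
    obtain ⟨A, a, M, b, B, h⟩ := hcross
    exact ⟨M.length, A, a, M, b, B, rfl, h⟩
  obtain ⟨A, a, M, b, B, hm, hZ, ha, hb⟩ := Nat.find_spec hex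
  have hmin : ∀ A' a' M' b' B', Z = (A' ++ [a']) ++ M' ++ (b' :: B') → Y a' → X b' →
      M.length ≤ M'.length := by
    intro A' a' M' b' B' h1 h2 h3
    rw [hm]
    exact Nat.find_min' hex ⟨A', a', M', b', B', rfl, h1, h2, h3⟩
  have hMX : ∀ m ∈ M, ¬ X m := by
    intro m hmM hX
    obtain ⟨M₁, M₂, rfl⟩ := List.append_of_mem hmM
    have := hmin A a M₁ m (M₂ ++ b :: B) (by simp [hZ]) ha hX
    simp at this
  have hMY : ∀ m ∈ M, ¬ Y m := by
    intro m hmM hY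
    obtain ⟨M₁, M₂, rfl⟩ := List.append_of_mem hmM
    have := hmin (A ++ a :: M₁) m M₂ b B (by simp [hZ]) hY hb
    simp at this
    omega
  refine ⟨A, a, M, b, B, hZ, ha, hb, fun h => hMX w h hXw, ?_⟩
  by_cases hM : M = []
  · exact Or.inl hM
  refine Or.inr ?_
  -- A consecutive pair in `Y × X` would be a crossing with empty gap.
  have hchain : Z.IsChain fun u v => ¬ (Y u ∧ X v) := by
    rw [List.isChain_iff_forall_rel_of_append_cons_cons]
    rintro u v l₁ l₂ h ⟨hu, hv⟩
    have := hmin l₁ u [] v l₂ (by simp [h]) hu hv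
    simp at this
    exact hM this
  have c1 : (A ++ [a]).IsChain fun u v => ¬ (Y u ∧ X v) :=
    hchain.infix ⟨[], M ++ b :: B, by simp [hZ]⟩
  have c2 : (b :: B).IsChain fun u v => ¬ (Y u ∧ X v) :=
    hchain.infix ⟨A ++ [a] ++ M, [], by simp [hZ]⟩
  obtain ⟨a', A', hA⟩ : ∃ a' A', A ++ [a] = a' :: A' := by
    cases A <;> simp
  have i2 := List.countP_add_countP_le_of_isChain B b c2
  have hXa' : ¬ X a' := by
    apply hhead
    rw [hZ, hA]; simp
  have hYl : ¬ Y ((b :: B).getLast (by simp)) := by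
    apply hlast
    rw [hZ, List.getLast?_append_of_ne_nil _ (by simp), List.getLast?_eq_getLast_of_ne_nil (by simp)]
    simp
  rw [hA] at c1
  have i1 := List.countP_add_countP_le_of_isChain A' a' c1
  have m1 : M.countP (X ·) = 0 := by rw [List.countP_eq_zero]; simpa using hMX
  have m2 : M.countP (Y ·) = 0 := by rw [List.countP_eq_zero]; simpa using hMY
  rw [hZ, hA]
  simp only [List.countP_append (l₁ := (a' :: A') ++ M), List.countP_append (l₁ := a' :: A'),
    m1, m2]
  rw [if_neg hXa'] at i1
  rw [if_neg hYl, if_pos hb] at i2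
  omega

/-- Adjacency in the cone over `G`, obtained from `G` by adding a universal vertex `none`. -/
def coneGraph {V : Type*} (G : SimpleGraph V) : SimpleGraph (Option V) where
  Adj
    | some a, some b => G.Adj a b
    | none, some _ => True
    | some _, none => True
    | none, none => False
  symm := ⟨by rintro (_ | a) (_ | b) <;> simp [G.adj_comm]⟩
  loopless := ⟨by rintro (_ | a) <;> simp⟩

@[simp] theorem coneGraph_adj_some_some {V : Type*} {G : SimpleGraph V} {a b : V} :
    (coneGraph G).Adj (some a) (some b) ↔ G.Adj a b := Iff.rfl

@[simp] theorem coneGraph_adj_some_none {V : Type*} {G : SimpleGraph V} {a : V} :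
    (coneGraph G).Adj (some a) none := trivial

@[simp] theorem coneGraph_adj_none_some {V : Type*} {G : SimpleGraph V} {a : V} :
    (coneGraph G).Adj none (some a) := trivial

/-- A cycle through the apex of the cone over `G` leaves a path of `G`. -/
theorem exists_isPathList_of_cone_cycle {V : Type*} {G : SimpleGraph V} {c : List (Option V)}
    (hc : IsPathList (coneGraph G) c) (hn : none ∈ c)
    (hclose : ∀ u ∈ c.getLast?, ∀ v ∈ c.head?, (coneGraph G).Adj u v) :
    ∃ l, IsPathList G l ∧ l.length + 1 = c.length := by
  obtain ⟨c₁, c₂, rfl⟩ := List.append_of_mem hn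
  have hnot : ∀ z ∈ c₂ ++ c₁, z ≠ none := by
    have := hc.2
    rw [List.nodup_middle, List.nodup_cons] at this
    rintro z hz rfl
    exact this.1 (by simpa [or_comm] using hz)
  obtain ⟨l, hl⟩ : ∃ l : List V, l.map some = c₂ ++ c₁ := by
    refine ⟨(c₂ ++ c₁).reduceOption, ?_⟩
    generalize c₂ ++ c₁ = d at hnot
    induction d with
    | nil => rfl
    | cons a d ih =>
      cases a with
      | none => exact absurd rfl (hnot none (by simp))
      | some a => simp [ih (fun z hz => hnot z (by simp [hz]))]
  -- Cut the cycle at the apex: the closing edge joins the end of `c₂` to the start of `c₁`.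
  have hpath : (c₂ ++ c₁).IsChain (coneGraph G).Adj := by
    rw [List.isChain_append]
    refine ⟨hc.1.infix ⟨c₁ ++ [none], [], by simp⟩, hc.1.infix ⟨[], none :: c₂, by simp⟩, ?_⟩
    intro u hu v hv
    apply hclose
    · cases c₂ with
      | nil => simp at hu
      | cons z c₂ => simpa using hu
    · cases c₁ with
      | nil => simp at hv
      | cons z c₁ => simpa using hv
  have hnd : (c₂ ++ c₁).Nodup := by
    have := hc.2
    rw [List.nodup_middle, List.nodup_cons] at this
    exact List.nodup_append_comm.1 this.2
  refine ⟨l, ⟨?_, ?_⟩, ?_⟩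
  · rw [← hl, List.isChain_map] at hpath
    exact hpath
  · rw [← hl] at hnd
    exact hnd.of_map
  · have := congrArg List.length hl
    simp at this ⊢
    omega

/-- Kopylov's lemma for linear forests with two components: a connected graph which contains two
disjoint paths starting in `x` and in `y` has a path at least as long as prescribed by the total
number of vertices and by the degrees of `x` and `y` into the forest. -/
theorem exists_long_path_of_countP {V : Type*} {G : SimpleGraph V} [DecidableRel G.Adj]
    (hG : G.Connected) {x y : V} {P Q : List V} (hP : IsPathList G (x :: P))
    (hQ : IsPathList G (y :: Q)) (hdisj : (x :: P).Disjoint (y :: Q)) {k : ℕ}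
    (hk : k ≤ (x :: P).length + (y :: Q).length)
    (hdeg : k ≤ ((x :: P) ++ (y :: Q)).countP (G.Adj x ·) +
      ((x :: P) ++ (y :: Q)).countP (G.Adj y ·) + 1) :
    ∃ l, IsPathList G l ∧ k ≤ l.length := by
  classical
  by_cases hcr : (∃ z ∈ y :: Q, G.Adj x z) ∨ (∃ z ∈ x :: P, G.Adj y z)
  -- The apex links the two paths into one path from `x` to `y`. A crossing, a neighbour `a` of `y`
  -- before a neighbour `b` of `x`, closes it to a cycle omitting only the gap. As the apex is
  -- adjacent to `x`, the gap can avoid it, so deleting it leaves a path of `G`.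
  · set Z : List (Option V) := (x :: P).map some ++ none :: (y :: Q).reverse.map some with hZdef
    have hZconcat : Z = ((x :: P).map some ++ none :: Q.reverse.map some) ++ [some y] := by
      simp [hZdef]
    have hcount : ∀ u : V, Z.countP ((coneGraph G).Adj (some u) ·) =
        ((x :: P) ++ (y :: Q)).countP (G.Adj u ·) + 1 := by
      intro u
      rw [hZdef, List.countP_append, List.countP_cons, List.countP_map, List.countP_map,
        List.countP_reverse, List.countP_append]
      simp only [coneGraph_adj_some_none, decide_true, if_true, Function.comp_def,
        coneGraph_adj_some_some]
      omega
    have hZ : IsPathList (coneGraph G) Z := by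
      constructor
      · rw [hZdef, List.isChain_append]
        refine ⟨?_, ?_, ?_⟩
        · rw [List.isChain_map]; exact hP.1
        · rw [List.isChain_cons]
          refine ⟨?_, ?_⟩
          · intro z hz
            obtain ⟨v, hv, rfl⟩ := List.mem_map.1 (List.mem_of_mem_head? hz)
            simp
          · rw [List.isChain_map]; exact isChain_adj_reverse hQ.1
        · intro u hu v hv
          obtain ⟨u, -, rfl⟩ := List.mem_map.1 (List.mem_of_mem_getLast? hu)
          simp at hv
          subst hv
          simp
      · rw [hZdef, List.nodup_middle, List.nodup_cons]
        refine ⟨by simp, ?_⟩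
        rw [← List.map_append]
        refine List.Nodup.map (Option.some_injective _) ?_
        rw [List.nodup_append']
        refine ⟨hP.2, List.nodup_reverse.2 hQ.2, ?_⟩
        intro z h1 h2
        exact hdisj h1 (List.mem_reverse.1 h2)
    have hcross : ∃ A a M b B, Z = (A ++ [a]) ++ M ++ (b :: B) ∧
        (coneGraph G).Adj (some y) a ∧ (coneGraph G).Adj (some x) b := by
      rcases hcr with ⟨z, hz, hxz⟩ | ⟨z, hz, hyz⟩
      · obtain ⟨Q₁, Q₂, h⟩ := List.append_of_mem hz
        exact ⟨(x :: P).map some, none, Q₂.reverse.map some, some z, Q₁.reverse.map some,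
          by rw [hZdef, h]; simp, by simp, hxz⟩
      · obtain ⟨P₁, P₂, h⟩ := List.append_of_mem hz
        exact ⟨P₁.map some, some z, P₂.map some, none, (y :: Q).reverse.map some,
          by rw [hZdef, h]; simp, hyz, by simp⟩
    obtain ⟨A, a, M, b, B, hsplit, ha, hb, hM, hlen⟩ := List.exists_minimal_crossing
      (X := ((coneGraph G).Adj (some x) ·)) (Y := ((coneGraph G).Adj (some y) ·)) (w := none)
      (Z := Z) (by simp) (by intro u hu; simp [hZdef] at hu; simp [← hu])
      (by
        intro u hu
        rw [hZconcat, List.getLast?_append_of_ne_nil _ (by simp)] at hu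
        simp at hu
        simp [← hu]) hcross
    have hZhead : (A ++ [a]).head? = some (some x) := by
      have := congrArg List.head? hsplit
      cases A <;> simp_all
    have hZlast : (b :: B).getLast? = some (some y) := by
      have := congrArg List.getLast? hsplit
      rw [List.getLast?_append_of_ne_nil (l₂ := b :: B) _ (by simp)] at this
      rw [← this, hZconcat, List.getLast?_append_of_ne_nil _ (by simp)]
      simp
    have hcyc : IsPathList (coneGraph G) ((A ++ [a]) ++ (b :: B).reverse) := by
      constructor
      · rw [List.isChain_append]
        refine ⟨hZ.1.infix ⟨[], M ++ b :: B, by simp [hsplit]⟩,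
          isChain_adj_reverse (hZ.1.infix ⟨A ++ [a] ++ M, [], by simp [hsplit]⟩), ?_⟩
        intro u hu v hv
        rw [List.head?_reverse, hZlast] at hv
        simp at hu hv
        subst hu hv
        exact ha.symm
      · have h1 := hZ.2
        rw [hsplit] at h1
        have h2 : ((A ++ [a]) ++ (b :: B)).Nodup := h1.sublist (by simp)
        rw [List.nodup_append'] at h2 ⊢
        exact ⟨h2.1, List.nodup_reverse.2 h2.2.1,
          fun z hz hz' => h2.2.2 hz (List.mem_reverse.1 hz')⟩
    obtain ⟨l, hl, hll⟩ := exists_isPathList_of_cone_cycle hcyc (by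
        have : none ∈ Z := by simp [hZdef]
        rw [hsplit] at this
        simp at this ⊢
        tauto) (by
      intro u hu v hv
      rw [List.head?_append_of_ne_nil _ (by simp), hZhead] at hv
      rw [List.getLast?_append_of_ne_nil _ (by simp), List.getLast?_reverse] at hu
      simp at hu hv
      subst hu hv
      exact hb.symm)
    refine ⟨l, hl, ?_⟩
    simp only [List.length_append, List.length_reverse] at hll
    -- With an empty gap all vertices of both paths are kept. Otherwise the cycle has at least `d(x)
    -- + d(y) + 2` vertices, where each degree into the cone counts the apex once; removing the apex
    -- leaves `d(x) + d(y) + 1 ≥ k`.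
    rcases hlen with rfl | hlen
    · have h1 := congrArg List.length hsplit
      simp [hZdef] at h1
      simp at hll hk
      omega
    · have h1 := hcount x
      have h2 := hcount y
      simp only [List.length_append] at hlen
      omega
  · rw [not_or] at hcr
    obtain ⟨hx, hy⟩ := hcr
    obtain ⟨l, hl, hll⟩ := exists_long_path_of_noncrossing hG hP hQ hdisj
    refine ⟨l, hl, ?_⟩
    have h1 : (y :: Q).countP (G.Adj x ·) = 0 := by
      rw [List.countP_eq_zero]; simpa using hx
    have h2 : (x :: P).countP (G.Adj y ·) = 0 := by
      rw [List.countP_eq_zero]; simpa using hy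
    rw [List.countP_append, List.countP_append] at hdeg
    omega

/-! ### Path-saturated graphs -/

/-- `G` has no path on `k` vertices, but every additional edge creates one. -/
def IsPathSaturated {V : Type*} (G : SimpleGraph V) (k : ℕ) : Prop :=
  (∀ l, IsPathList G l → l.length < k) ∧
    ∀ x y, x ≠ y → ¬ G.Adj x y → ∃ l, IsPathList (G ⊔ edge x y) l ∧ k ≤ l.length

theorem exists_isPathSaturated {V : Type*} [Finite V] (G : SimpleGraph V) (k : ℕ)
    (hG : ∀ l, IsPathList G l → l.length < k) : ∃ G', G ≤ G' ∧ IsPathSaturated G' k := by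
  obtain ⟨G', hle, hmax⟩ := Set.Finite.exists_le_maximal
    (s := {G' : SimpleGraph V | ∀ l, IsPathList G' l → l.length < k}) (Set.toFinite _) hG
  refine ⟨G', hle, hmax.1, fun x y hxy hadj => ?_⟩
  by_contra! hno
  have := hmax.2 (y := G' ⊔ edge x y) hno le_sup_left
  exact hadj (this (Or.inr (by simp [edge_adj, hxy])))

/-- A long path of `G + xy` must use the new edge; cutting it there leaves two paths of `G`, neither
of which contains both ends of that edge. -/
theorem IsPathSaturated.exists_forest {V : Type*} {G : SimpleGraph V} {k : ℕ}
    (hG : IsPathSaturated G k) {x y : V} (hxy : x ≠ y) (hadj : ¬ G.Adj x y) :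
    ∃ P Q, IsPathList G (x :: P) ∧ IsPathList G (y :: Q) ∧ (x :: P).Disjoint (y :: Q) ∧
      k ≤ (x :: P).length + (y :: Q).length := by
  obtain ⟨l, hl, hk⟩ := hG.2 x y hxy hadj
  have hn : ¬ l.IsChain G.Adj := fun h => absurd (hG.1 l ⟨h, hl.2⟩) (by omega)
  rw [List.isChain_iff_forall_rel_of_append_cons_cons] at hn
  push Not at hn
  obtain ⟨a, b, l₁, l₂, rfl, hab⟩ := hn
  have hsup : ∀ u v, (G ⊔ edge x y).Adj u v → G.Adj u v ∨ (u = x ∧ v = y) ∨ (u = y ∧ v = x) := by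
    intro u v h
    rw [sup_adj, edge_adj] at h
    tauto
  have hadj' : (G ⊔ edge x y).Adj a b := (List.isChain_iff_forall_rel_of_append_cons_cons.1 hl.1) rfl
  have hnd : (l₁ ++ [a] ++ (b :: l₂)).Nodup := by simpa using hl.2
  rw [List.nodup_append'] at hnd
  obtain ⟨n1, n2, nd⟩ := hnd
  have key : (a = x ∧ b = y) ∨ (a = y ∧ b = x) := (hsup a b hadj').resolve_left hab
  have c1 : IsPathList G (l₁ ++ [a]) := by
    refine ⟨?_, n1⟩
    have : (l₁ ++ [a]).IsChain (G ⊔ edge x y).Adj := hl.1.infix ⟨[], b :: l₂, by simp⟩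
    refine this.imp_of_mem_imp ?_
    intro u v hu hv huv
    rcases hsup u v huv with h | h
    · exact h
    · exfalso
      have : b = u ∨ b = v := by grind
      rcases this with rfl | rfl
      · exact nd hu (by simp)
      · exact nd hv (by simp)
  have c2 : IsPathList G (b :: l₂) := by
    refine ⟨?_, n2⟩
    have : (b :: l₂).IsChain (G ⊔ edge x y).Adj := hl.1.infix ⟨l₁ ++ [a], [], by simp⟩
    refine this.imp_of_mem_imp ?_
    intro u v hu hv huv
    rcases hsup u v huv with h | h
    · exact h
    · exfalso
      have : a = u ∨ a = v := by grind
      rcases this with rfl | rfl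
      · exact nd (by simp) hu
      · exact nd (by simp) hv
  have c1' := c1.reverse
  simp only [List.reverse_append, List.reverse_singleton, List.singleton_append] at c1'
  have nd' : (a :: l₁.reverse).Disjoint (b :: l₂) := by
    intro z hz hz'
    refine nd ?_ hz'
    simpa [or_comm] using hz
  simp at hk
  rcases key with ⟨rfl, rfl⟩ | ⟨rfl, rfl⟩
  · exact ⟨_, _, c1', c2, nd', by simp; omega⟩
  · exact ⟨_, _, c2, c1', nd'.symm, by simp; omega⟩

theorem card_filter_adj_le_countP {V : Type*} {G : SimpleGraph V} [DecidableRel G.Adj] {x : V}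
    {X : Finset V} {L : List V} (h : ∀ z ∈ X, G.Adj x z → z ∈ L) :
    (X.filter (G.Adj x ·)).card ≤ L.countP (G.Adj x ·) := by
  classical
  rw [List.countP_eq_length_filter]
  refine le_trans (Finset.card_le_card (t := (L.filter (G.Adj x ·)).toFinset) ?_)
    (List.toFinset_card_le _)
  intro z hz
  rw [Finset.mem_filter] at hz
  simp [hz.2, h z hz.1 hz.2]

/-- Used to show that a common neighbour of `x` and `y` lies on one of the two paths when these are
long. -/
theorem IsPathList.cons_append {V : Type*} {G : SimpleGraph V} {x y : V} {P Q : List V}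
    (hP : IsPathList G (x :: P)) (hQ : IsPathList G (y :: Q))
    (hdisj : (x :: P).Disjoint (y :: Q)) {z : V} (hx : G.Adj x z) (hy : G.Adj z y)
    (hzP : z ∉ x :: P) (hzQ : z ∉ y :: Q) :
    IsPathList G ((x :: P).reverse ++ z :: (y :: Q)) := by
  constructor
  · rw [List.isChain_append]
    refine ⟨hP.reverse.1, List.isChain_cons_cons.2 ⟨hy, hQ.1⟩, ?_⟩
    intro u hu v hv
    simp at hu hv
    subst hu hv
    exact hx
  · rw [List.nodup_append']
    refine ⟨hP.reverse.2, List.nodup_cons.2 ⟨hzQ, hQ.2⟩, ?_⟩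
    intro u hu hv
    rw [List.mem_reverse] at hu
    rcases List.mem_cons.1 hv with rfl | hv
    · exact hzP hu
    · exact hdisj hu hv

/-- In a connected graph which is saturated for paths on `k` vertices, any vertex of a set with
inner degrees at least `p` is adjacent to any vertex of a set with inner degrees at least `q`, if
`p + q ≥ k - 1`. -/
theorem IsPathSaturated.adj_of_inner_degree {V : Type*} [Fintype V] {G : SimpleGraph V}
    [DecidableRel G.Adj] {k : ℕ} (hG : IsPathSaturated G k) (hconn : G.Connected)
    {X Y : Finset V} {p q : ℕ} (hX : ∀ x ∈ X, p ≤ (X.filter (G.Adj x ·)).card)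
    (hY : ∀ y ∈ Y, q ≤ (Y.filter (G.Adj y ·)).card) (hpq : k ≤ p + q + 1)
    {x y : V} (hx : x ∈ X) (hy : y ∈ Y) (hxy : x ≠ y) : G.Adj x y := by
  by_contra hadj
  -- Choose the nonadjacent pair and its two paths with the largest total number of vertices. Both
  -- endpoints may vary, so that prepending a vertex of `X` or `Y` is a legitimate competitor.
  let S : Set ℕ := {m | ∃ x ∈ X, ∃ y ∈ Y, x ≠ y ∧ ¬ G.Adj x y ∧ ∃ P Q, IsPathList G (x :: P) ∧
    IsPathList G (y :: Q) ∧ (x :: P).Disjoint (y :: Q) ∧ (x :: P).length + (y :: Q).length = m}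
  have hSb : BddAbove S := by
    refine ⟨Fintype.card V, ?_⟩
    rintro m ⟨x, -, y, -, -, -, P, Q, hP, hQ, hd, rfl⟩
    rw [← List.length_append]
    exact List.Nodup.length_le_card (List.nodup_append'.2 ⟨hP.2, hQ.2, hd⟩)
  obtain ⟨P₀, Q₀, hP₀, hQ₀, hd₀, hk₀⟩ := hG.exists_forest hxy hadj
  have hS0 : (x :: P₀).length + (y :: Q₀).length ∈ S :=
    ⟨x, hx, y, hy, hxy, hadj, P₀, Q₀, hP₀, hQ₀, hd₀, rfl⟩
  have hmem := Nat.sSup_mem ⟨_, hS0⟩ hSb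
  have hkm := hk₀.trans (le_csSup hSb hS0)
  have hmax : ∀ m ∈ S, m ≤ sSup S := fun m hm => le_csSup hSb hm
  generalize sSup S = M at *
  clear hS0 hk₀ hd₀ hQ₀ hP₀ hxy hadj hx hy
  obtain ⟨x, hx, y, hy, hxy, hadj, P, Q, hP, hQ, hd, rfl⟩ := hmem
  have hlong : ∀ z, G.Adj x z → G.Adj z y → z ∈ (x :: P) ++ (y :: Q) := by
    intro z h1 h2
    by_contra hz
    rw [List.mem_append, not_or] at hz
    have := hG.1 _ (hP.cons_append hQ hd h1 h2 hz.1 hz.2)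
    rw [List.length_append, List.length_reverse, List.length_cons (as := y :: Q)] at this
    omega
  -- A neighbour `z` off the paths either is adjacent to `y`, and then joins both paths into a long
  -- one, or replaces `x` after being prepended, against maximality. So the paths see the full inner
  -- degree of `x`.
  have hnx : ∀ z ∈ X, G.Adj x z → z ∈ (x :: P) ++ (y :: Q) := by
    intro z hz hxz
    by_contra hzn
    have hzn' := hzn
    rw [List.mem_append, not_or] at hzn
    by_cases hzy : G.Adj z y
    · exact hzn' (hlong z hxz hzy)
    have := hmax (((z :: x :: P)).length + (y :: Q).length) ⟨z, hz, y, hy, by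
        rintro rfl; exact hzn.2 (by simp), hzy, x :: P, Q,
        ⟨List.isChain_cons_cons.2 ⟨hxz.symm, hP.1⟩, List.nodup_cons.2 ⟨hzn.1, hP.2⟩⟩, hQ, by
          rw [List.disjoint_cons_left]; exact ⟨hzn.2, hd⟩, rfl⟩
    simp at this
  have hny : ∀ z ∈ Y, G.Adj y z → z ∈ (x :: P) ++ (y :: Q) := by
    intro z hz hyz
    by_contra hzn
    have hzn' := hzn
    rw [List.mem_append, not_or] at hzn
    by_cases hxz : G.Adj x z
    · exact hzn' (hlong z hxz hyz.symm)
    have := hmax ((x :: P).length + (z :: y :: Q).length) ⟨x, hx, z, hz, by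
        rintro rfl; exact hzn.1 (by simp), hxz, P, y :: Q, hP,
        ⟨List.isChain_cons_cons.2 ⟨hyz.symm, hQ.1⟩, List.nodup_cons.2 ⟨hzn.2, hQ.2⟩⟩, by
          rw [List.disjoint_cons_right]; exact ⟨hzn.1, hd⟩, rfl⟩
    simp at this
  have d1 := (hX x hx).trans (card_filter_adj_le_countP hnx)
  have d2 := (hY y hy).trans (card_filter_adj_le_countP hny)
  obtain ⟨l, hl, hlk⟩ := exists_long_path_of_countP hconn hP hQ hd hkm (by omega)
  have := hG.1 l hl
  omega

/-- The vertices of a clique form a path in any order. -/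
theorem IsPathSaturated.card_lt_of_isClique {V : Type*} {G : SimpleGraph V} {k : ℕ}
    (hG : IsPathSaturated G k) {H : Finset V} (hH : ∀ x ∈ H, ∀ y ∈ H, x ≠ y → G.Adj x y) : H.card < k := by
  have := hG.1 H.toList ⟨?_, H.nodup_toList⟩
  · simpa using this
  · refine List.Pairwise.isChain (List.Pairwise.imp_of_mem ?_ H.nodup_toList)
    intro x y hx hy hxy
    exact hH x (Finset.mem_toList.1 hx) y (Finset.mem_toList.1 hy) hxy

/-! ### Counting ordered bicliques -/

/-- The pairs of an `s`-set and a `t`-set of vertices in `W` which span a complete bipartite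
subgraph of `G`. -/
def bicliques {V : Type*} (G : SimpleGraph V) [DecidableRel G.Adj] (W : Finset V) (s t : ℕ) :
    Finset (Finset V × Finset V) :=
  (W.powersetCard s ×ˢ W.powersetCard t).filter fun p => ∀ x ∈ p.1, ∀ y ∈ p.2, G.Adj x y

section

variable {V : Type*} {G : SimpleGraph V} [DecidableRel G.Adj] {W : Finset V}
  {s t : ℕ}

theorem mem_bicliques {p : Finset V × Finset V} : p ∈ bicliques G W s t ↔
    (p.1 ⊆ W ∧ p.1.card = s) ∧ (p.2 ⊆ W ∧ p.2.card = t) ∧ ∀ x ∈ p.1, ∀ y ∈ p.2, G.Adj x y := by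
  simp only [bicliques, Finset.mem_filter, Finset.mem_product, Finset.mem_powersetCard]
  tauto

variable [DecidableEq V]

theorem card_bicliques_filter_fst (v : V) :
    ((bicliques G W s t).filter (v ∈ ·.1)).card = ((bicliques G W t s).filter (v ∈ ·.2)).card := by
  refine Finset.card_nbij' Prod.swap Prod.swap ?_ ?_ (fun _ _ => rfl) (fun _ _ => rfl)
  all_goals
    intro p hp
    simp only [Finset.coe_filter, Set.mem_ofPred_eq, mem_bicliques, Prod.fst_swap,
      Prod.snd_swap] at hp ⊢
    exact ⟨⟨hp.1.2.1, hp.1.1, fun x hx y hy => (hp.1.2.2 y hy x hx).symm⟩, hp.2⟩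

/-- By looplessness `v` lies on at most one side. Bicliques with `v` on the first side are swapped,
so that one estimate, with `s` and `t` exchanged, serves both terms. -/
theorem card_bicliques_eq_erase_add (v : V) :
    (bicliques G W s t).card = (bicliques G (W.erase v) s t).card +
      (((bicliques G W s t).filter (v ∈ ·.2)).card +
        ((bicliques G W t s).filter (v ∈ ·.2)).card) := by
  rw [← card_bicliques_filter_fst (s := s) (t := t),
    ← Finset.card_filter_add_card_filter_not (s := bicliques G W s t) (v ∈ ·.2),
    ← Finset.card_filter_add_card_filter_not
      (s := (bicliques G W s t).filter (fun p => ¬ v ∈ p.2)) (v ∈ ·.1)]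
  have h1 : ((bicliques G W s t).filter (fun p => ¬ v ∈ p.2)).filter (v ∈ ·.1) =
      (bicliques G W s t).filter (v ∈ ·.1) := by
    ext p
    simp only [Finset.mem_filter, mem_bicliques]
    constructor
    · tauto
    · rintro ⟨h, hv⟩
      exact ⟨⟨h, fun hv' => G.irrefl (h.2.2 v hv v hv')⟩, hv⟩
  have h2 : ((bicliques G W s t).filter (fun p => ¬ v ∈ p.2)).filter (fun p => ¬ v ∈ p.1) =
      bicliques G (W.erase v) s t := by
    ext p
    simp only [Finset.mem_filter, mem_bicliques, Finset.subset_erase]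
    tauto
  rw [h1, h2]
  ring

theorem card_sigma_powersetCard (N U : Finset V) (hN : N ⊆ U) (a b : ℕ) :
    ((N.powersetCard a).sigma fun S => (U \ S).powersetCard b).card =
      N.card.choose a * (U.card - a).choose b := by
  rw [Finset.card_sigma, Finset.sum_congr rfl (g := fun _ => (U.card - a).choose b)]
  · simp
  · intro S hS
    rw [Finset.mem_powersetCard] at hS
    rw [Finset.card_powersetCard, Finset.card_sdiff_of_subset (hS.1.trans hN), hS.2]

/-- The side opposite `v` consists of neighbours of `v`, and the other `t - 1` vertices beside `v`
avoid both `v` and that side. -/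
theorem card_bicliques_filter_snd_le {v : V} (hv : v ∈ W) :
    ((bicliques G W s t).filter (v ∈ ·.2)).card ≤
      (W.filter (G.Adj v ·)).card.choose s * (W.card - 1 - s).choose (t - 1) := by
  rw [← Finset.card_erase_of_mem hv, ← card_sigma_powersetCard]
  · refine Finset.card_le_card_of_injOn (fun p => ⟨p.1, p.2.erase v⟩) ?_ ?_
    · rintro ⟨S, T⟩ hp
      simp only [Finset.coe_filter, Set.mem_ofPred_eq, mem_bicliques] at hp
      obtain ⟨⟨⟨h1, h2⟩, ⟨h3, h4⟩, h5⟩, h6⟩ := hp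
      simp only [Finset.coe_sigma, Set.mem_sigma_iff, Finset.mem_coe, Finset.mem_powersetCard]
      refine ⟨⟨?_, h2⟩, ?_, ?_⟩
      · intro x hx
        exact Finset.mem_filter.2 ⟨h1 hx, (h5 x hx v h6).symm⟩
      · intro y hy
        rw [Finset.mem_erase] at hy
        rw [Finset.mem_sdiff, Finset.mem_erase]
        exact ⟨⟨hy.1, h3 hy.2⟩, fun hyS => G.irrefl (h5 y hyS y hy.2)⟩
      · rw [Finset.card_erase_of_mem h6, h4]
    · rintro ⟨S, T⟩ hp ⟨S', T'⟩ hp' h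
      simp only [Finset.coe_filter, Set.mem_ofPred_eq] at hp hp'
      simp only [Sigma.mk.injEq, heq_eq_eq] at h
      rw [h.1, ← Finset.insert_erase hp.2, ← Finset.insert_erase hp'.2, h.2]
  · intro x hx
    rw [Finset.mem_filter] at hx
    exact Finset.mem_erase.2 ⟨hx.2.ne', hx.1⟩

/-- When the neighbours of `v` dominate `W`, every choice counted by the upper bound is a biclique.
The vertices of `B` in the extremal graph are of this kind. -/
theorem card_bicliques_filter_snd_eq {v : V} (hv : v ∈ W) (ht : 1 ≤ t)
    (hN : ∀ x ∈ W, G.Adj v x → ∀ y ∈ W, y ≠ x → G.Adj x y) :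
    ((bicliques G W s t).filter (v ∈ ·.2)).card =
      (W.filter (G.Adj v ·)).card.choose s * (W.card - 1 - s).choose (t - 1) := by
  refine le_antisymm (card_bicliques_filter_snd_le hv) ?_
  rw [← Finset.card_erase_of_mem hv, ← card_sigma_powersetCard]
  · refine Finset.card_le_card_of_injOn (fun p => (p.1, insert v p.2)) ?_ ?_
    · rintro ⟨S, T⟩ hp
      simp only [Finset.coe_sigma, Set.mem_sigma_iff, Finset.mem_coe,
        Finset.mem_powersetCard] at hp
      obtain ⟨⟨h1, h2⟩, h3, h4⟩ := hp
      have hvT : v ∉ T := fun h => by simpa using h3 h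
      have hvS : v ∉ S := fun h => by simpa using h1 h
      simp only [Finset.coe_filter, Set.mem_ofPred_eq, mem_bicliques]
      refine ⟨⟨⟨fun x hx => (Finset.mem_filter.1 (h1 hx)).1, h2⟩, ⟨?_, ?_⟩, ?_⟩, by simp⟩
      · rw [Finset.insert_subset_iff]
        exact ⟨hv, fun y hy => (Finset.mem_erase.1 (Finset.mem_sdiff.1 (h3 hy)).1).2⟩
      · rw [Finset.card_insert_of_notMem hvT, h4]; omega
      · intro x hx y hy
        have hx' := Finset.mem_filter.1 (h1 hx)
        rcases Finset.mem_insert.1 hy with rfl | hy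
        · exact hx'.2.symm
        · have hy' := Finset.mem_sdiff.1 (h3 hy)
          refine hN x hx'.1 hx'.2 y (Finset.mem_erase.1 hy'.1).2 ?_
          rintro rfl
          exact hy'.2 hx
    · rintro ⟨S, T⟩ hp ⟨S', T'⟩ hp' h
      simp only [Finset.coe_sigma, Set.mem_sigma_iff, Finset.mem_coe,
        Finset.mem_powersetCard] at hp hp'
      have hvT : v ∉ T := fun h => by simpa using hp.2.1 h
      have hvT' : v ∉ T' := fun h => by simpa using hp'.2.1 h
      simp only [Prod.mk.injEq] at h
      rw [Sigma.mk.injEq, heq_eq_eq, ← Finset.erase_insert hvT, ← Finset.erase_insert hvT', h.2]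
      exact ⟨h.1, rfl⟩
  · intro x hx
    rw [Finset.mem_filter] at hx
    exact Finset.mem_erase.2 ⟨hx.2.ne', hx.1⟩

theorem choose_mul_choose_sub (n s t : ℕ) :
    n.choose s * (n - s).choose t = n.choose (s + t) * (s + t).choose s := by
  rw [Nat.choose_mul (Nat.le_add_right s t), Nat.add_sub_cancel_left]

theorem card_bicliques_le :
    (bicliques G W s t).card ≤ W.card.choose (s + t) * (s + t).choose s := by
  rw [← choose_mul_choose_sub, ← card_sigma_powersetCard W W subset_rfl]
  refine Finset.card_le_card_of_injOn (fun p => ⟨p.1, p.2⟩) ?_ ?_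
  · rintro ⟨S, T⟩ hp
    simp only [Finset.mem_coe, mem_bicliques] at hp
    simp only [Finset.coe_sigma, Set.mem_sigma_iff, Finset.mem_coe, Finset.mem_powersetCard]
    exact ⟨hp.1, fun y hy => Finset.mem_sdiff.2
      ⟨hp.2.1.1 hy, fun hyS => G.irrefl (hp.2.2 y hyS y hy)⟩, hp.2.1.2⟩
  · rintro ⟨S, T⟩ - ⟨S', T'⟩ - h
    simpa using h

theorem card_bicliques_eq_of_isClique (hW : ∀ x ∈ W, ∀ y ∈ W, x ≠ y → G.Adj x y) :
    (bicliques G W s t).card = W.card.choose (s + t) * (s + t).choose s := by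
  refine le_antisymm card_bicliques_le ?_
  rw [← choose_mul_choose_sub, ← card_sigma_powersetCard W W subset_rfl]
  refine Finset.card_le_card_of_injOn (fun p => (p.1, p.2)) ?_ ?_
  · rintro ⟨S, T⟩ hp
    simp only [Finset.coe_sigma, Set.mem_sigma_iff, Finset.mem_coe,
      Finset.mem_powersetCard] at hp
    simp only [Finset.mem_coe, mem_bicliques]
    refine ⟨hp.1, ⟨fun y hy => (Finset.mem_sdiff.1 (hp.2.1 hy)).1, hp.2.2⟩, fun x hx y hy => ?_⟩
    have hy' := Finset.mem_sdiff.1 (hp.2.1 hy)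
    refine hW x (hp.1.1 hx) y hy'.1 ?_
    rintro rfl
    exact hy'.2 hx
  · rintro ⟨S, T⟩ - ⟨S', T'⟩ - h
    simpa using h

end

theorem card_bicliques_mono {V : Type*} {G G' : SimpleGraph V} [DecidableRel G.Adj]
    [DecidableRel G'.Adj] (h : G ≤ G') (W : Finset V) (s t : ℕ) :
    (bicliques G W s t).card ≤ (bicliques G' W s t).card := by
  classical
  refine Finset.card_le_card fun p hp => ?_
  rw [mem_bicliques] at hp ⊢
  exact ⟨hp.1, hp.2.1, fun x hx y hy => h (hp.2.2 x hx y hy)⟩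

/-! ### From ordered bicliques to copies of the complete bipartite graph -/

/-- The subgraph of all edges of `G` between two sets of vertices. -/
def bicliqueSubgraph {V : Type*} (G : SimpleGraph V) (p : Finset V × Finset V) : G.Subgraph where
  verts := {x | x ∈ p.1 ∨ x ∈ p.2}
  Adj x y := G.Adj x y ∧ (x ∈ p.1 ∧ y ∈ p.2 ∨ x ∈ p.2 ∧ y ∈ p.1)
  adj_sub h := h.1
  edge_vert h := by
    have := h.2
    simp only [Set.mem_ofPred_eq]
    tauto
  symm := ⟨fun x y h => ⟨h.1.symm, by tauto⟩⟩

/-- The neighbourhood of a vertex in the subgraph is the opposite side, so one vertex, once its side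
is known, determines both sides. -/
theorem bicliqueSubgraph_eq_iff {V : Type*} [DecidableEq V] {G : SimpleGraph V}
    [DecidableRel G.Adj] {W : Finset V} {s t : ℕ} (hs : 1 ≤ s) (ht : 1 ≤ t)
    {p q : Finset V × Finset V} (hp : p ∈ bicliques G W s t) (hq : q ∈ bicliques G W s t) :
    bicliqueSubgraph G q = bicliqueSubgraph G p ↔ q = p ∨ q = p.swap := by
  constructor
  · intro h
    have hadj : ∀ x y, (G.Adj x y ∧ (x ∈ q.1 ∧ y ∈ q.2 ∨ x ∈ q.2 ∧ y ∈ q.1)) ↔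
        (G.Adj x y ∧ (x ∈ p.1 ∧ y ∈ p.2 ∨ x ∈ p.2 ∧ y ∈ p.1)) := by
      intro x y
      have := congrFun (congrFun (congrArg Subgraph.Adj h) x) y
      exact iff_of_eq this
    have hverts : ∀ x, (x ∈ q.1 ∨ x ∈ q.2) ↔ (x ∈ p.1 ∨ x ∈ p.2) := by
      intro x
      have := congrArg Subgraph.verts h
      exact Set.ext_iff.1 this x
    rw [mem_bicliques] at hp hq
    obtain ⟨⟨-, hp1⟩, ⟨-, hp2⟩, hpa⟩ := hp
    obtain ⟨⟨-, hq1⟩, ⟨-, hq2⟩, hqa⟩ := hq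
    have hpd : ∀ x, x ∈ p.1 → x ∉ p.2 := fun x h1 h2 => G.irrefl (hpa x h1 x h2)
    have hqd : ∀ x, x ∈ q.1 → x ∉ q.2 := fun x h1 h2 => G.irrefl (hqa x h1 x h2)
    obtain ⟨a, ha⟩ : q.1.Nonempty := Finset.card_pos.1 (by omega)
    obtain ⟨b, hb⟩ : q.2.Nonempty := Finset.card_pos.1 (by omega)
    rcases (hverts a).1 (Or.inl ha) with hap | hap
    · left
      have h2 : q.2 = p.2 := by
        ext y
        constructor
        · intro hy
          have := (hadj a y).1 ⟨hqa a ha y hy, Or.inl ⟨ha, hy⟩⟩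
          have := hpd a hap
          tauto
        · intro hy
          have := (hadj a y).2 ⟨hpa a hap y hy, Or.inl ⟨hap, hy⟩⟩
          have := hqd a ha
          tauto
      refine Prod.ext ?_ h2
      ext x
      have := hverts x
      have := hpd x
      have := hqd x
      rw [h2] at *
      tauto
    · right
      have h2 : q.2 = p.1 := by
        ext y
        constructor
        · intro hy
          have := (hadj a y).1 ⟨hqa a ha y hy, Or.inl ⟨ha, hy⟩⟩
          have := fun h => hpd a h hap
          tauto
        · intro hy
          have := (hadj a y).2 ⟨(hpa y hy a hap).symm, Or.inr ⟨hap, hy⟩⟩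
          have := hqd a ha
          tauto
      refine Prod.ext ?_ h2
      ext x
      have := hverts x
      have := hpd x
      have := hqd x
      rw [h2] at *
      simp only [Prod.fst_swap]
      tauto
  · rintro (rfl | rfl)
    · rfl
    · refine Subgraph.ext ?_ ?_
      · ext x; simp [bicliqueSubgraph, or_comm]
      · ext x y; simp [bicliqueSubgraph, or_comm]

/-- A fibre is a pair and its swap; for `s ≠ t` the swap has the wrong sizes. -/
theorem card_bicliques_eq_mul_card_image {V : Type*} [DecidableEq V] {G : SimpleGraph V}
    [DecidableRel G.Adj] [DecidableEq G.Subgraph] {W : Finset V} {s t : ℕ} (hs : 1 ≤ s)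
    (ht : 1 ≤ t) : (bicliques G W s t).card =
      (if s = t then 2 else 1) * ((bicliques G W s t).image (bicliqueSubgraph G)).card := by
  rw [Finset.card_eq_sum_card_image (bicliqueSubgraph G), Finset.sum_const_nat (m :=
    if s = t then 2 else 1), mul_comm]
  intro H hH
  obtain ⟨p, hp, rfl⟩ := Finset.mem_image.1 hH
  have hp' := mem_bicliques.1 hp
  split_ifs with h
  · have : (bicliques G W s t).filter (fun q => bicliqueSubgraph G q = bicliqueSubgraph G p) =
        {p, p.swap} := by
      ext q
      rw [Finset.mem_filter, Finset.mem_insert, Finset.mem_singleton]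
      constructor
      · rintro ⟨hq, he⟩
        exact (bicliqueSubgraph_eq_iff hs ht hp hq).1 he
      · intro hq
        have hq' : q ∈ bicliques G W s t := by
          rcases hq with rfl | rfl
          · exact hp
          · subst h
            exact mem_bicliques.2 ⟨hp'.2.1, hp'.1, fun x hx y hy => (hp'.2.2 y hy x hx).symm⟩
        exact ⟨hq', (bicliqueSubgraph_eq_iff hs ht hp hq').2 hq⟩
    rw [this, Finset.card_pair]
    intro he
    have h12 : p.1 = p.2 := congrArg Prod.fst he
    obtain ⟨a, ha⟩ : p.1.Nonempty := Finset.card_pos.1 (by omega)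
    exact G.irrefl (hp'.2.2 a ha a (h12 ▸ ha))
  · have : (bicliques G W s t).filter (fun q => bicliqueSubgraph G q = bicliqueSubgraph G p) =
        {p} := by
      ext q
      rw [Finset.mem_filter, Finset.mem_singleton]
      constructor
      · rintro ⟨hq, he⟩
        rcases (bicliqueSubgraph_eq_iff hs ht hp hq).1 he with h' | rfl
        · exact h'
        · have hq' := mem_bicliques.1 hq
          simp only [Prod.fst_swap, Prod.snd_swap] at hq'
          omega
      · rintro rfl
        exact ⟨hp, rfl⟩
    rw [this, Finset.card_singleton]

theorem copy_toSubgraph_eq_bicliqueSubgraph {V : Type*} [DecidableEq V] {G : SimpleGraph V}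
    {s t : ℕ} (c : (completeBipartiteGraph (Fin s) (Fin t)).Copy G) :
    c.toSubgraph = bicliqueSubgraph G
      (Finset.univ.image fun i => c (Sum.inl i), Finset.univ.image fun i => c (Sum.inr i)) := by
  refine Subgraph.ext ?_ ?_
  · ext x
    simp [bicliqueSubgraph, Copy.toSubgraph]
  · ext x y
    simp only [bicliqueSubgraph, Copy.toSubgraph, Subgraph.map_adj, Relation.Map, Subgraph.top_adj,
      Finset.mem_image, Finset.mem_univ, true_and]
    constructor
    · rintro ⟨u, v, huv, rfl, rfl⟩
      refine ⟨c.toHom.map_rel huv, ?_⟩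
      rcases u with u | u <;> rcases v with v | v <;> simp at huv ⊢
    · rintro ⟨-, ⟨⟨i, rfl⟩, ⟨j, rfl⟩⟩ | ⟨⟨i, rfl⟩, ⟨j, rfl⟩⟩⟩
      · exact ⟨Sum.inl i, Sum.inr j, by simp, rfl, rfl⟩
      · exact ⟨Sum.inr i, Sum.inl j, by simp, rfl, rfl⟩

theorem exists_copy_of_mem_bicliques {V : Type*} [DecidableEq V] {G : SimpleGraph V}
    [DecidableRel G.Adj] {W : Finset V} {s t : ℕ} {p : Finset V × Finset V}
    (hp : p ∈ bicliques G W s t) :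
    ∃ c : (completeBipartiteGraph (Fin s) (Fin t)).Copy G,
      (Finset.univ.image (fun i => c (Sum.inl i)), Finset.univ.image fun i => c (Sum.inr i)) =
        p := by
  obtain ⟨⟨-, h1⟩, ⟨-, h2⟩, h3⟩ := mem_bicliques.1 hp
  let e₁ := (p.1.equivFinOfCardEq h1).symm
  let e₂ := (p.2.equivFinOfCardEq h2).symm
  refine ⟨⟨⟨Sum.elim (fun i => (e₁ i : V)) (fun i => (e₂ i : V)), ?_⟩, ?_⟩, ?_⟩
  · rintro (i | i) (j | j) h <;> simp at h ⊢
    · exact h3 _ (e₁ i).2 _ (e₂ j).2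
    · exact (h3 _ (e₁ j).2 _ (e₂ i).2).symm
  · rintro (i | i) (j | j) h <;> simp at h ⊢
    · exact h
    · exact G.irrefl (h ▸ h3 _ (e₁ i).2 _ (e₂ j).2)
    · exact G.irrefl (h ▸ h3 _ (e₁ j).2 _ (e₂ i).2)
    · exact h
  · refine Prod.ext ?_ ?_
    · ext x
      simp only [Finset.mem_image, Finset.mem_univ, true_and]
      constructor
      · rintro ⟨i, rfl⟩; exact (e₁ i).2
      · intro hx; exact ⟨e₁.symm ⟨x, hx⟩, congrArg Subtype.val (e₁.apply_symm_apply ⟨x, hx⟩)⟩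
    · ext x
      simp only [Finset.mem_image, Finset.mem_univ, true_and]
      constructor
      · rintro ⟨i, rfl⟩; exact (e₂ i).2
      · intro hx; exact ⟨e₂.symm ⟨x, hx⟩, congrArg Subtype.val (e₂.apply_symm_apply ⟨x, hx⟩)⟩

theorem card_bicliques_univ {V : Type*} [Fintype V] {G : SimpleGraph V} [DecidableRel G.Adj]
    {s t : ℕ} (hs : 1 ≤ s) (ht : 1 ≤ t) :
    (bicliques G Finset.univ s t).card =
      (if s = t then 2 else 1) * G.copyCount (completeBipartiteGraph (Fin s) (Fin t)) := by
  classical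
  rw [card_bicliques_eq_mul_card_image hs ht, copyCount_eq_card_image_copyToSubgraph]
  congr 2
  ext H
  simp only [Finset.mem_image, Finset.mem_univ, true_and]
  constructor
  · rintro ⟨p, hp, rfl⟩
    obtain ⟨c, rfl⟩ := exists_copy_of_mem_bicliques hp
    exact ⟨c, copy_toSubgraph_eq_bicliqueSubgraph c⟩
  · rintro ⟨c, rfl⟩
    refine ⟨_, mem_bicliques.2 ⟨⟨Finset.subset_univ _, ?_⟩, ⟨Finset.subset_univ _, ?_⟩, ?_⟩,
      (copy_toSubgraph_eq_bicliqueSubgraph c).symm⟩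
    · exact (Finset.card_image_of_injective _ (c.injective.comp Sum.inl_injective)).trans (by simp)
    · exact (Finset.card_image_of_injective _ (c.injective.comp Sum.inr_injective)).trans (by simp)
    · intro x hx y hy
      simp only [Finset.mem_image, Finset.mem_univ, true_and] at hx hy
      obtain ⟨i, rfl⟩ := hx
      obtain ⟨j, rfl⟩ := hy
      exact c.toHom.map_rel (by simp)

/-! ### The bound and its convexity -/

/-- The sum of the bounds on the numbers of ordered bicliques which are destroyed by deleting
vertices of degree `a` one by one until `L` of `n` vertices are left, and of the number of ordered
bicliques of the complete graph on these `L` vertices. -/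
def bicliqueBound (s t n L a : ℕ) : ℕ :=
  (∑ j ∈ Finset.Ico L n,
    (a.choose s * (j - s).choose (t - 1) + a.choose t * (j - t).choose (s - 1))) +
  L.choose (s + t) * (s + t).choose s

theorem bicliqueBound_succ {s t n L a : ℕ} (h : L ≤ n) :
    bicliqueBound s t (n + 1) L a = bicliqueBound s t n L a +
      (a.choose s * (n - s).choose (t - 1) + a.choose t * (n - t).choose (s - 1)) := by
  rw [bicliqueBound, bicliqueBound, Finset.sum_Ico_succ_top h]
  ring

theorem bicliqueBound_self (s t L a : ℕ) :
    bicliqueBound s t L L a = L.choose (s + t) * (s + t).choose s := by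
  simp [bicliqueBound]

/-- Reindex by `j = n - i`. For `s = t` the two summands coincide, and the factor 2 cancels the
division because `C(2s,s)` is even. -/
theorem bicliqueBound_eq_gFun {s t n k a : ℕ} (hs : 1 ≤ s) (hk : k ≤ n) (ha : a ≤ k) :
    bicliqueBound s t n (k - a) a = (if s = t then 2 else 1) * gFun s t n k a := by
  have hsum : ∀ f : ℕ → ℕ, ∑ j ∈ Finset.Ico (k - a) n, f j =
      ∑ i ∈ Finset.Icc 1 (n - k + a), f (n - i) := by
    intro f
    refine Finset.sum_nbij' (fun j => n - j) (fun i => n - i) ?_ ?_ ?_ ?_ ?_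
    · intro j hj; simp only [Finset.mem_Ico, Finset.mem_Icc] at hj ⊢; omega
    · intro j hj; simp only [Finset.mem_Ico, Finset.mem_Icc] at hj ⊢; omega
    · intro j hj; simp only [Finset.mem_Ico] at hj ⊢; omega
    · intro j hj; simp only [Finset.mem_Icc] at hj ⊢; omega
    · intro j hj
      simp only [Finset.mem_Ico] at hj
      rw [Nat.sub_sub_self hj.2.le]
  rw [bicliqueBound, gFun, hsum]
  simp only [Nat.sub_right_comm n _ s, Nat.sub_right_comm n _ t]
  split_ifs with h
  · subst h
    have h2 : 2 ∣ (k - a).choose (2 * s) * (2 * s).choose s := by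
      obtain ⟨s, rfl⟩ : ∃ s', s = s' + 1 := ⟨s - 1, by omega⟩
      exact Dvd.dvd.mul_left (Nat.two_dvd_centralBinom_succ s) _
    rw [mul_add, Nat.mul_div_cancel' h2, Finset.mul_sum, two_mul s]
    congr 1
    exact Finset.sum_congr rfl fun i _ => by ring
  · rw [one_mul]

theorem choose_second_difference (m t : ℕ) :
    (m + 2).choose (t + 2) + m.choose (t + 2) = 2 * (m + 1).choose (t + 2) + m.choose t := by
  simp only [Nat.choose_succ_succ', show m + 2 = (m + 1) + 1 from rfl,
    show t + 2 = (t + 1) + 1 from rfl]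
  ring

theorem two_mul_choose_succ_le (m t : ℕ) :
    2 * (m + 1).choose t ≤ m.choose t + (m + 2).choose t := by
  rcases t with _ | _ | t
  · simp
  · simp; omega
  · have := choose_second_difference m t
    simp only [Nat.add_assoc, Nat.reduceAdd] at this ⊢
    omega

theorem sum_Ico_choose_sub {s t L n : ℕ} (ht : 1 ≤ t) (hs : s ≤ L) (hL : L ≤ n) :
    ∑ j ∈ Finset.Ico L n, (j - s).choose (t - 1) + (L - s).choose t = (n - s).choose t := by
  induction n, hL using Nat.le_induction with
  | base => simp
  | succ n hn ih =>
    obtain ⟨t, rfl⟩ : ∃ t', t = t' + 1 := ⟨t - 1, by omega⟩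
    rw [Finset.sum_Ico_succ_top hn, Nat.sub_add_comm (hs.trans hn), Nat.choose_succ_succ']
    simp only [Nat.add_sub_cancel] at ih ⊢
    omega

/-- The second difference of `C(·,t)` is `C(·,t-2)`, or zero for `t = 1`. Replacing `C(a,s)` by
`C(m,s)` makes the error a multinomial term comparable with the clique term. -/
theorem choose_mul_second_difference_le {a s t m : ℕ} (ht : 1 ≤ t) (hs : s ≤ m) (ha : a ≤ m) :
    a.choose s * ((m + 2 - s).choose t + (m - s).choose t) ≤
      a.choose s * (2 * (m + 1 - s).choose t) +
        m.choose (s + t - 2) * (s + t - 2).choose s := by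
  rw [Nat.sub_add_comm hs, Nat.sub_add_comm hs]
  rcases t with _ | _ | t
  · omega
  · refine le_add_right (Nat.mul_le_mul_left _ ?_)
    simp only [zero_add, Nat.choose_one_right]
    omega
  · rw [choose_second_difference, mul_add]
    refine Nat.add_le_add_left ?_ _
    rw [show s + (t + 2) - 2 = s + t from by omega, ← choose_mul_choose_sub]
    exact Nat.mul_le_mul_right _ (Nat.choose_le_choose _ ha)

/-- The deletion sum alone need not be convex; the last term is the defect, to be absorbed by the
convexity of the clique term. -/
theorem two_mul_sum_choose_le {s t n k a : ℕ} (ht : 1 ≤ t) (hk : k ≤ n) (ha : 2 * (a + 2) ≤ k) :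
    2 * ∑ j ∈ Finset.Ico (k - (a + 1)) n, (a + 1).choose s * (j - s).choose (t - 1) ≤
      ∑ j ∈ Finset.Ico (k - a) n, a.choose s * (j - s).choose (t - 1) +
      ∑ j ∈ Finset.Ico (k - (a + 2)) n, (a + 2).choose s * (j - s).choose (t - 1) +
      (k - (a + 2)).choose (s + t - 2) * (s + t - 2).choose s := by
  simp only [← Finset.mul_sum]
  by_cases hsa : a + 2 < s
  · simp [Nat.choose_eq_zero_of_lt (show a + 1 < s by omega)]
  obtain ⟨m, hm⟩ : ∃ m, k = m + (a + 2) := ⟨k - (a + 2), by omega⟩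
  have e0 : k - a = m + 2 := by omega
  have e1 : k - (a + 1) = m + 1 := by omega
  have e2 : k - (a + 2) = m := by omega
  rw [e0, e1, e2]
  have s0 := sum_Ico_choose_sub (s := s) (L := m + 2) (n := n) ht (by omega) (by omega)
  have s1 := sum_Ico_choose_sub (s := s) (L := m + 1) (n := n) ht (by omega) (by omega)
  have s2 := sum_Ico_choose_sub (s := s) (L := m) (n := n) ht (by omega) (by omega)
  have hd := choose_mul_second_difference_le (a := a) (s := s) (t := t) (m := m) ht (by omega)
    (by omega)
  have hf := two_mul_choose_succ_le a s
  have hf1 : a.choose s ≤ (a + 1).choose s := Nat.choose_le_choose _ (by omega)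
  have hφ : (m - s).choose t ≤ (m + 1 - s).choose t := Nat.choose_le_choose _ (by omega)
  have hN : (m - s).choose t ≤ (n - s).choose t := Nat.choose_le_choose _ (by omega)
  generalize ∑ j ∈ Finset.Ico (m + 2) n, (j - s).choose (t - 1) = S0 at *
  generalize ∑ j ∈ Finset.Ico (m + 1) n, (j - s).choose (t - 1) = S1 at *
  generalize ∑ j ∈ Finset.Ico m n, (j - s).choose (t - 1) = S2 at *
  generalize (m + 2 - s).choose t = p0 at *
  generalize (m + 1 - s).choose t = p1 at *
  generalize (m - s).choose t = p2 at *
  generalize (n - s).choose t = N at *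
  generalize a.choose s = f0 at *
  generalize (a + 1).choose s = f1 at *
  generalize (a + 2).choose s = f2 at *
  generalize m.choose (s + t - 2) * (s + t - 2).choose s = K at *
  zify at *
  rw [eq_sub_of_add_eq s0, eq_sub_of_add_eq s1, eq_sub_of_add_eq s2]
  -- By the hockey-stick identity the sums are `f_i (N - p_i)`. Their second difference is `(f0 + f2
  -- - 2 f1)(N - p2) + 2 (f1 - f0)(p1 - p2) - f0 (p0 + p2 - 2 p1)`; only the last term can be
  -- negative, and it is at least `-K`.
  nlinarith [mul_nonneg (sub_nonneg.2 hf) (sub_nonneg.2 hN),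
    mul_nonneg (sub_nonneg.2 hf1) (sub_nonneg.2 hφ)]

/-- Expand the right side by Pascal's rule twice. This lets the second difference of the clique term
pay for the defects of both deletion sums. -/
theorem choose_add_choose_le {s t : ℕ} (hs : 1 ≤ s) (ht : 1 ≤ t) :
    (s + t - 2).choose s + (s + t - 2).choose t ≤ (s + t).choose s := by
  obtain ⟨s, rfl⟩ : ∃ s', s = s' + 1 := ⟨s - 1, by omega⟩
  obtain ⟨t, rfl⟩ : ∃ t', t = t' + 1 := ⟨t - 1, by omega⟩
  rw [show s + 1 + (t + 1) - 2 = s + t from by omega,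
    show s + 1 + (t + 1) = s + t + 1 + 1 from by omega]
  rcases s with _ | s
  · rw [Nat.choose_succ_succ', Nat.choose_succ_succ']
    simp
    omega
  · have h : (s + 1 + t).choose (t + 1) = (s + 1 + t).choose s :=
      Nat.choose_symm_of_eq_add (by omega)
    rw [h, Nat.choose_succ_succ', Nat.choose_succ_succ', Nat.choose_succ_succ' _ (s + 1)]
    omega

/-- The bound is a convex function of the degree parameter. -/
theorem two_mul_bicliqueBound_le {s t n k a : ℕ} (hs : 1 ≤ s) (ht : 1 ≤ t) (hk : k ≤ n)
    (ha : 2 * (a + 2) ≤ k) :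
    2 * bicliqueBound s t n (k - (a + 1)) (a + 1) ≤
      bicliqueBound s t n (k - a) a + bicliqueBound s t n (k - (a + 2)) (a + 2) := by
  have h1 := two_mul_sum_choose_le (s := s) ht hk ha
  have h2 := two_mul_sum_choose_le (s := t) (t := s) hs hk ha
  rw [add_comm t s] at h2
  have h3 := Nat.mul_le_mul_left ((k - (a + 2)).choose (s + t - 2)) (choose_add_choose_le hs ht)
  have h4 : (k - a).choose (s + t) * (s + t).choose s +
      (k - (a + 2)).choose (s + t) * (s + t).choose s =
      2 * ((k - (a + 1)).choose (s + t) * (s + t).choose s) +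
        (k - (a + 2)).choose (s + t - 2) * (s + t).choose s := by
    have := choose_second_difference (k - (a + 2)) (s + t - 2)
    rw [show k - (a + 2) + 2 = k - a from by omega,
      show k - (a + 2) + 1 = k - (a + 1) from by omega,
      show s + t - 2 + 2 = s + t from by omega] at this
    rw [← add_mul, this]
    ring
  simp only [bicliqueBound, Finset.sum_add_distrib]
  rw [mul_add] at h3
  omega

/-- If `f a > f r`, some step between `r` and `a` goes up, and by convexity all later steps up to
`h` do too. -/
theorem le_max_of_two_mul_le {f : ℕ → ℕ} {r h : ℕ}
    (hf : ∀ a, r ≤ a → a + 2 ≤ h → 2 * f (a + 1) ≤ f a + f (a + 2)) {a : ℕ} (hra : r ≤ a)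
    (hah : a ≤ h) : f a ≤ max (f r) (f h) := by
  by_contra! hlt
  rw [max_lt_iff] at hlt
  have hinc : ∀ b, a ≤ b → b ≤ h → f a ≤ f b := by
    have hra' : r < a := lt_of_le_of_ne hra (by rintro rfl; exact lt_irrefl _ hlt.1)
    obtain ⟨c, hrc, hca, hc⟩ : ∃ c, r ≤ c ∧ c < a ∧ f c < f (c + 1) := by
      by_contra! hno
      have : ∀ b, r ≤ b → b ≤ a → f b ≤ f r := by
        intro b hb
        induction b, hb using Nat.le_induction with
        | base => simp
        | succ b hb ih => intro hba; exact (hno b hb hba).trans (ih (by omega))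
      exact absurd (this a hra le_rfl) (by omega)
    have hstep : ∀ b, c ≤ b → b + 1 ≤ h → f b < f (b + 1) := by
      intro b hb
      induction b, hb using Nat.le_induction with
      | base => exact fun _ => hc
      | succ b hb ih =>
        intro hbh
        have := ih (by omega)
        have := hf b (by omega) (by omega)
        simp only [Nat.add_assoc, Nat.reduceAdd] at this ⊢
        omega
    intro b hb
    induction b, hb using Nat.le_induction with
    | base => exact fun _ => le_rfl
    | succ b hb ih =>
      intro hbh
      exact (ih (by omega)).trans (hstep b (by omega) hbh).le
  exact absurd (hinc h hah le_rfl) (by omega)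

/-! ### Degree cores and the upper bound -/

/-- If every vertex set strictly above `H` has a vertex outside `H` of inner degree at most `a`,
then the number of bicliques is bounded by deleting these vertices one by one. -/
theorem card_bicliques_le_bicliqueBound {V : Type*} [DecidableEq V] {G : SimpleGraph V}
    [DecidableRel G.Adj] {H : Finset V} {a L s t : ℕ} (hHL : H.card ≤ L)
    (hdis : ∀ W, H ⊂ W → ∃ v ∈ W, v ∉ H ∧ (W.filter (G.Adj v ·)).card ≤ a)
    {n : ℕ} (hn : L ≤ n) (W : Finset V) (hW : W.card = n) (hHW : H ⊆ W) :
    (bicliques G W s t).card ≤ bicliqueBound s t n L a := by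
  induction n, hn using Nat.le_induction generalizing W with
  | base =>
    rw [bicliqueBound_self, ← hW]
    exact card_bicliques_le
  | succ n hn ih =>
    obtain ⟨v, hv, hvH, hva⟩ := hdis W (Finset.ssubset_iff_subset_ne.2 ⟨hHW, by
      rintro rfl; omega⟩)
    have hc : (W.erase v).card = n := by rw [Finset.card_erase_of_mem hv, hW]; rfl
    have hn' : W.card - 1 = n := by omega
    rw [card_bicliques_eq_erase_add v, bicliqueBound_succ hn]
    refine Nat.add_le_add (ih _ hc (Finset.subset_erase.2 ⟨hHW, hvH⟩)) (Nat.add_le_add ?_ ?_)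
    · refine (card_bicliques_filter_snd_le hv).trans ?_
      rw [hn']
      exact Nat.mul_le_mul_right _ (Nat.choose_le_choose _ hva)
    · refine (card_bicliques_filter_snd_le hv).trans ?_
      rw [hn']
      exact Nat.mul_le_mul_right _ (Nat.choose_le_choose _ hva)

open Classical in
/-- The largest vertex set all of whose inner degrees are greater than `a`. -/
noncomputable def degreeCore {V : Type*} [Fintype V] (G : SimpleGraph V) [DecidableRel G.Adj]
    (a : ℕ) : Finset V :=
  Finset.univ.filter fun v => ∃ S : Finset V, v ∈ S ∧ ∀ x ∈ S, a + 1 ≤ (S.filter (G.Adj x ·)).card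

section

variable {V : Type*} [Fintype V] {G : SimpleGraph V} [DecidableRel G.Adj]

theorem subset_degreeCore {a : ℕ} {S : Finset V}
    (hS : ∀ x ∈ S, a + 1 ≤ (S.filter (G.Adj x ·)).card) : S ⊆ degreeCore G a := fun v hv => by
  classical
  exact Finset.mem_filter.2 ⟨Finset.mem_univ _, S, hv, hS⟩

theorem degreeCore_degree {a : ℕ} {x : V} (hx : x ∈ degreeCore G a) :
    a + 1 ≤ ((degreeCore G a).filter (G.Adj x ·)).card := by
  classical
  obtain ⟨-, S, hxS, hS⟩ := Finset.mem_filter.1 hx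
  exact (hS x hxS).trans (Finset.card_le_card
    (Finset.filter_subset_filter _ (subset_degreeCore hS)))

theorem degreeCore_anti {a b : ℕ} (h : a ≤ b) : degreeCore G b ⊆ degreeCore G a :=
  subset_degreeCore fun _ hx => (Nat.succ_le_succ h).trans (degreeCore_degree hx)

/-- Otherwise all inner degrees of `W` exceed `a`, so `W` lies in the core. This provides the
vertices to delete. -/
theorem exists_degree_le_of_degreeCore_ssubset {a : ℕ} (W : Finset V) (hW : degreeCore G a ⊂ W) :
    ∃ v ∈ W, v ∉ degreeCore G a ∧ (W.filter (G.Adj v ·)).card ≤ a := by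
  by_contra! hno
  refine hW.2 (subset_degreeCore fun x hx => ?_)
  by_cases hxc : x ∈ degreeCore G a
  · exact (degreeCore_degree hxc).trans (Finset.card_le_card (Finset.filter_subset_filter _ hW.1))
  · exact hno x hx hxc

/-- If `2 r ≥ k - 1`, saturation makes the whole graph a clique on at least `k` vertices. -/
theorem IsPathSaturated.degree_bound_le {k r : ℕ} (hG : IsPathSaturated G k)
    (hconn : G.Connected) (hn : k ≤ Fintype.card V)
    (hdeg : ∀ v, r ≤ (Finset.univ.filter (G.Adj v ·)).card) : r ≤ (k - 2) / 2 := by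
  by_contra! hr
  have := hG.card_lt_of_isClique (H := Finset.univ) fun x hx y hy hxy =>
    hG.adj_of_inner_degree hconn (fun v _ => hdeg v) (fun v _ => hdeg v) (by omega) hx hy hxy
  rw [Finset.card_univ] at this
  omega

/-- The upper bound on the number of bicliques of a connected path-saturated graph. -/
theorem IsPathSaturated.card_bicliques_le {k r s t : ℕ} (hk : 4 ≤ k) (hs : 1 ≤ s) (ht : 1 ≤ t)
    (hG : IsPathSaturated G k) (hconn : G.Connected)
    (hn : k ≤ Fintype.card V) (hdeg : ∀ v, r ≤ (Finset.univ.filter (G.Adj v ·)).card) :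
    (bicliques G Finset.univ s t).card ≤
      max (bicliqueBound s t (Fintype.card V) (k - 1 - r) r)
        (bicliqueBound s t (Fintype.card V) (k - 1 - (k - 2) / 2) ((k - 2) / 2)) := by
  classical
  set h := (k - 2) / 2 with hh
  by_cases hcard : (degreeCore G h).card ≤ k - 1 - h
  · refine le_max_of_le_right ?_
    exact card_bicliques_le_bicliqueBound hcard exists_degree_le_of_degreeCore_ssubset (by omega)
      Finset.univ rfl (Finset.subset_univ _)
  set H := degreeCore G h with hH
  have hclique : ∀ x ∈ H, ∀ y ∈ H, x ≠ y → G.Adj x y := fun x hx y hy hxy =>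
    hG.adj_of_inner_degree hconn (fun _ => degreeCore_degree) (fun _ => degreeCore_degree)
      (by omega) hx hy hxy
  have hHk : H.card < k := hG.card_lt_of_isClique hclique
  -- Chosen so that `(|H| - 1) + (α + 1) = k - 1`, the threshold of the adjacency criterion between
  -- `H` and the `α`-core.
  set α := k - 1 - H.card with hα
  have hHdeg : ∀ x ∈ H, H.card - 1 ≤ (H.filter (G.Adj x ·)).card := by
    intro x hx
    rw [← Finset.card_erase_of_mem hx]
    refine Finset.card_le_card fun y hy => ?_
    rw [Finset.mem_erase] at hy
    exact Finset.mem_filter.2 ⟨hy.2, hclique x hx y hy.2 hy.1.symm⟩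
  have hsub : degreeCore G α ⊆ H := by
    intro y hy
    by_contra hyH
    -- A vertex joined to all of `H` has more than `h` neighbours there, since `|H| ≥ k - h`, so `H`
    -- could be enlarged by it.
    refine hyH (subset_degreeCore (S := insert y H) ?_ (Finset.mem_insert_self y H))
    have hyadj : ∀ x ∈ H, G.Adj x y := fun x hx =>
      hG.adj_of_inner_degree hconn hHdeg (fun _ => degreeCore_degree) (by omega) hx hy
        (by rintro rfl; exact hyH hx)
    intro x hx
    rcases Finset.mem_insert.1 hx with rfl | hx
    · have : H.card ≤ ((insert x H).filter (G.Adj x ·)).card :=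
        Finset.card_le_card fun z hz => Finset.mem_filter.2
          ⟨Finset.mem_insert_of_mem hz, (hyadj z hz).symm⟩
      omega
    · exact (degreeCore_degree hx).trans (Finset.card_le_card
        (Finset.filter_subset_filter _ (Finset.subset_insert y H)))
  have hαh : α ≤ h := by omega
  have hcore : degreeCore G α = H := Finset.Subset.antisymm hsub (degreeCore_anti hαh)
  -- If `α < r`, all vertices belong to the `α`-core `H`, which has fewer than `k` elements.
  have hrα : r ≤ α := by
    by_contra! hlt
    have huniv : (Finset.univ : Finset V) ⊆ degreeCore G α :=
      subset_degreeCore fun x _ => le_trans (by omega) (hdeg x)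
    have := Finset.card_le_card huniv
    rw [hcore, Finset.card_univ] at this
    omega
  have hle : (bicliques G Finset.univ s t).card ≤
      bicliqueBound s t (Fintype.card V) (k - 1 - α) α :=
    card_bicliques_le_bicliqueBound (by rw [hcore]; omega) exists_degree_le_of_degreeCore_ssubset
      (by omega) Finset.univ rfl (Finset.subset_univ _)
  refine hle.trans ?_
  exact le_max_of_two_mul_le (f := fun a => bicliqueBound s t (Fintype.card V) (k - 1 - a) a)
    (fun a _ hah => two_mul_bicliqueBound_le hs ht (by omega) (by omega)) hrα hαh

end

/-- The upper bound on the number of copies of a complete bipartite graph in a connected graph of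
minimum degree at least `r` without a path on `k` vertices. -/
theorem copyCount_completeBipartiteGraph_le {V : Type*} [Fintype V] {G : SimpleGraph V}
    [DecidableRel G.Adj] {k r s t : ℕ} (hk : 4 ≤ k) (hs : 1 ≤ s) (ht : 1 ≤ t) (hconn : G.Connected)
    (hn : k ≤ Fintype.card V) (hdeg : r ≤ G.minDegree)
    (hfree : ∀ l, IsPathList G l → l.length < k) :
    G.copyCount (completeBipartiteGraph (Fin s) (Fin t)) ≤
      max (gFun s t (Fintype.card V) (k - 1) r)
        (gFun s t (Fintype.card V) (k - 1) ((k - 2) / 2)) := by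
  classical
  obtain ⟨G', hle, hsat⟩ := exists_isPathSaturated G k hfree
  have hdeg' : ∀ v, r ≤ (Finset.univ.filter (G'.Adj v ·)).card := by
    intro v
    refine (hdeg.trans (G.minDegree_le_degree v)).trans ?_
    rw [← card_neighborFinset_eq_degree]
    refine Finset.card_le_card fun w hw => ?_
    rw [mem_neighborFinset] at hw
    exact Finset.mem_filter.2 ⟨Finset.mem_univ _, hle hw⟩
  have hr := hsat.degree_bound_le (hconn.mono hle) hn hdeg'
  have hb := (card_bicliques_mono hle Finset.univ s t).trans
    (hsat.card_bicliques_le hk hs ht (hconn.mono hle) hn hdeg')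
  rw [card_bicliques_univ hs ht, bicliqueBound_eq_gFun hs (by omega) (by omega),
    bicliqueBound_eq_gFun hs (by omega) (by omega), Nat.mul_max_mul_left] at hb
  exact Nat.le_of_mul_le_mul_left hb (by split_ifs <;> norm_num)

/-! ### The extremal graph -/

theorem extremalGraph_adj {n k a : ℕ} {x y : Fin a ⊕ Fin (n - k + a) ⊕ Fin (k - 2 * a)} :
    (extremalGraph n k a).Adj x y ↔ x ≠ y ∧ (x.isLeft ∨ y.isLeft ∨
      (x.elim (fun _ => False) (·.isRight) ∧ y.elim (fun _ => False) (·.isRight))) := by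
  rw [extremalGraph, fromRel_adj]
  rcases x with x | x | x <;> rcases y with y | y | y <;> simp

theorem extremalGraph_card {n k a : ℕ} (ha : 2 * a ≤ k) (hk : k ≤ n) :
    Fintype.card (Fin a ⊕ Fin (n - k + a) ⊕ Fin (k - 2 * a)) = n := by
  simp only [Fintype.card_sum, Fintype.card_fin]
  omega

theorem extremalGraph_connected {n k a : ℕ} (ha : 1 ≤ a) : (extremalGraph n k a).Connected := by
  refine (connected_iff_exists_forall_reachable _).2 ⟨Sum.inl ⟨0, ha⟩, fun y => ?_⟩
  by_cases h : Sum.inl ⟨0, ha⟩ = y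
  · rw [h]
  · exact (extremalGraph_adj.2 ⟨h, Or.inl rfl⟩).reachable

theorem extremalGraph_le_minDegree {n k a : ℕ} (ha : 1 ≤ a) :
    a ≤ (extremalGraph n k a).minDegree := by
  classical
  have : Nonempty (Fin a ⊕ Fin (n - k + a) ⊕ Fin (k - 2 * a)) := ⟨Sum.inl ⟨0, ha⟩⟩
  refine le_minDegree_of_forall_le_degree _ _ fun v => ?_
  rw [← card_neighborFinset_eq_degree]
  rcases v with v | v
  · refine (Nat.le_add_left a (n - k)).trans ?_
    have := Finset.card_le_card_of_injOn (s := (Finset.univ : Finset (Fin (n - k + a))))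
      (t := (extremalGraph n k a).neighborFinset (Sum.inl v)) (fun i => Sum.inr (Sum.inl i))
      (fun i _ => by simp [extremalGraph_adj]) (fun i _ j _ h => by simpa using h)
    simpa using this
  · have := Finset.card_le_card_of_injOn (s := (Finset.univ : Finset (Fin a)))
      (t := (extremalGraph n k a).neighborFinset (Sum.inr v)) Sum.inl
      (fun i _ => by simp [extremalGraph_adj]) (fun i _ j _ h => by simpa using h)
    simpa using this

/-- Start from the clique `A ∪ C` and add the vertices of `B` one at a time: each has degree `a` and
its neighbours are universal, so every deletion estimate is an equality. -/
theorem card_bicliques_extremalGraph {n k a s t : ℕ} (hs : 1 ≤ s) (ht : 1 ≤ t) (ha : 2 * a ≤ k)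
    (B : Finset (Fin (n - k + a))) :
    (bicliques (extremalGraph n k a) (Finset.univ.disjSum (B.disjSum Finset.univ)) s t).card =
      bicliqueBound s t (k - a + B.card) (k - a) a := by
  classical
  have hcard : ∀ B : Finset (Fin (n - k + a)),
      ((Finset.univ : Finset (Fin a)).disjSum
        (B.disjSum (Finset.univ : Finset (Fin (k - 2 * a))))).card = k - a + B.card := by
    intro B
    simp only [Finset.card_disjSum, Finset.card_univ, Fintype.card_fin]
    omega
  induction B using Finset.induction_on with
  | empty =>
    rw [Finset.card_empty, add_zero, bicliqueBound_self, card_bicliques_eq_of_isClique, hcard,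
      Finset.card_empty, add_zero]
    intro x hx y hy hxy
    rw [extremalGraph_adj]
    rcases x with x | x | x <;> rcases y with y | y | y <;> simp_all
  | insert b B hb ih =>
    set W := (Finset.univ : Finset (Fin a)).disjSum
      ((insert b B).disjSum (Finset.univ : Finset (Fin (k - 2 * a)))) with hW
    have hbW : Sum.inr (Sum.inl b) ∈ W := by simp [hW]
    have herase : W.erase (Sum.inr (Sum.inl b)) = Finset.univ.disjSum (B.disjSum Finset.univ) := by
      ext x
      rcases x with x | x | x
      · simp [hW]
      · simp only [hW, Finset.mem_erase, Finset.inr_mem_disjSum, Finset.inl_mem_disjSum,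
          Finset.mem_insert, ne_eq, Sum.inr.injEq, Sum.inl.injEq]
        constructor
        · tauto
        · intro hx
          exact ⟨by rintro rfl; exact hb hx, Or.inr hx⟩
      · simp [hW]
    have hdeg : (W.filter ((extremalGraph n k a).Adj (Sum.inr (Sum.inl b)) ·)).card = a := by
      have : W.filter ((extremalGraph n k a).Adj (Sum.inr (Sum.inl b)) ·) =
          Finset.univ.image Sum.inl := by
        ext x
        rw [Finset.mem_filter, extremalGraph_adj]
        rcases x with x | x | x <;> simp [hW]
      rw [this, Finset.card_image_of_injective _ Sum.inl_injective]
      simp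
    have huniv : ∀ x ∈ W, (extremalGraph n k a).Adj (Sum.inr (Sum.inl b)) x → ∀ y ∈ W, y ≠ x →
        (extremalGraph n k a).Adj x y := by
      intro x _ hx y _ hyx
      rw [extremalGraph_adj] at hx ⊢
      rcases x with x | x
      · exact ⟨hyx.symm, Or.inl rfl⟩
      · simp at hx
    have hWc : W.card - 1 = k - a + B.card := by
      rw [hcard, Finset.card_insert_of_notMem hb]
      rfl
    rw [card_bicliques_eq_erase_add (Sum.inr (Sum.inl b)), herase, ih,
      card_bicliques_filter_snd_eq hbW ht huniv, card_bicliques_filter_snd_eq hbW hs huniv, hdeg,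
      hWc, Finset.card_insert_of_notMem hb, ← add_assoc (k - a),
      bicliqueBound_succ (Nat.le_add_right _ _)]

theorem extremalGraph_copyCount {n k a s t : ℕ} (hs : 1 ≤ s) (ht : 1 ≤ t) (ha : 2 * a ≤ k)
    (hk : k ≤ n) :
    (extremalGraph n k a).copyCount (completeBipartiteGraph (Fin s) (Fin t)) =
      gFun s t n k a := by
  have h := card_bicliques_extremalGraph (n := n) hs ht ha Finset.univ
  rw [Finset.univ_disjSum_univ, Finset.univ_disjSum_univ, card_bicliques_univ hs ht,
    Finset.card_univ, Fintype.card_fin, show k - a + (n - k + a) = n from by omega,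
    bicliqueBound_eq_gFun hs hk (by omega)] at h
  exact Nat.eq_of_mul_eq_mul_left (by split_ifs <;> norm_num) h

/-- On a walk in the extremal graph the vertices of `B` outnumber those of `A` by at most one, and
not at all if the walk starts in `A` or visits `C`. -/
theorem countP_le_of_isChain_extremalGraph {n k a : ℕ}
    (l : List (Fin a ⊕ Fin (n - k + a) ⊕ Fin (k - 2 * a)))
    (x : Fin a ⊕ Fin (n - k + a) ⊕ Fin (k - 2 * a))
    (h : (x :: l).IsChain (extremalGraph n k a).Adj) :
    (x :: l).countP (fun y => y.elim (fun _ => false) (·.isLeft)) +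
      (if (x :: l).countP (fun y => y.elim (fun _ => false) (·.isRight)) = 0 then 0 else 1) ≤
      (x :: l).countP (·.isLeft) + if x.isLeft then 0 else 1 := by
  induction l generalizing x with
  | nil => rcases x with x | x | x <;> simp
  | cons y l ih =>
    rw [List.isChain_cons_cons, extremalGraph_adj] at h
    have := ih y h.2
    have hadj := h.1.2
    rw [List.countP_cons (l := y :: l), List.countP_cons (l := y :: l),
      List.countP_cons (l := y :: l)]
    generalize (y :: l).countP (fun y => y.elim (fun _ => false) (·.isLeft)) = b at *
    generalize (y :: l).countP (fun y => y.isLeft) = c at *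
    have hd : y.elim (fun _ => False) (·.isRight) →
        (y :: l).countP (fun y => y.elim (fun _ => false) (·.isRight)) ≠ 0 := by
      intro hy
      rw [List.countP_cons]
      rcases y with y | y | y <;> simp_all
    generalize (y :: l).countP (fun y => y.elim (fun _ => false) (·.isRight)) = d at *
    rcases x with x | x | x <;> rcases y with y | y | y <;> simp at hadj hd this ⊢ <;>
      split_ifs at this ⊢ <;> omega

theorem length_le_of_isPathList_extremalGraph {n k a : ℕ} (ha : 2 * a < k)
    {l : List (Fin a ⊕ Fin (n - k + a) ⊕ Fin (k - 2 * a))}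
    (hl : IsPathList (extremalGraph n k a) l) : l.length ≤ k := by
  classical
  have hbound : ∀ {α : Type} [Fintype α] (f : α → Fin a ⊕ Fin (n - k + a) ⊕ Fin (k - 2 * a))
      (p : Fin a ⊕ Fin (n - k + a) ⊕ Fin (k - 2 * a) → Bool),
      (∀ x, p x → ∃ i, f i = x) → l.countP p ≤ Fintype.card α := by
    intro α _ f p hp
    rw [List.countP_eq_length_filter, ← List.toFinset_card_of_nodup (hl.2.filter p),
      ← Finset.card_univ]
    refine (Finset.card_le_card (t := Finset.univ.image f) fun x hx => ?_).trans
      Finset.card_image_le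
    obtain ⟨i, rfl⟩ := hp x (List.mem_filter.1 (List.mem_toFinset.1 hx)).2
    simp
  have hA := hbound Sum.inl (·.isLeft) (by rintro (x | x | x) h <;> simp at h ⊢)
  have hC := hbound (fun i => Sum.inr (Sum.inr i))
    (fun y => y.elim (fun _ => false) (·.isRight)) (by rintro (x | x | x) h <;> simp at h ⊢)
  rw [Fintype.card_fin] at hA hC
  have hsum : l.length = l.countP (·.isLeft) +
      l.countP (fun y => y.elim (fun _ => false) (·.isLeft)) +
      l.countP (fun y => y.elim (fun _ => false) (·.isRight)) := by
    clear hA hC hbound hl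
    induction l with
    | nil => simp
    | cons x l ih => rcases x with x | x | x <;> simp [ih, List.countP_cons] <;> omega
  rcases l with _ | ⟨x, l⟩
  · simp
  -- A path missing `C` has at most `2 a + 1 ≤ k` vertices; one meeting `C` has at most `2 a + |C| =
  -- k`.
  have h := countP_le_of_isChain_extremalGraph l x hl.1
  rw [hsum]
  split_ifs at h <;> omega

theorem theorem2p5 (n k r s t : ℕ) (hs : 1 ≤ s) (ht : 1 ≤ t) (hr : 1 ≤ r) (hk : 4 ≤ k)
    (hn : k ≤ n) :
    -- the bound: too many copies of `K_{s,t}` force a path on `k` vertices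
    (∀ (V : Type*) [Fintype V] (G : SimpleGraph V) [DecidableRel G.Adj],
      Fintype.card V = n → G.Connected → r ≤ G.minDegree →
      max (gFun s t n (k - 1) r) (gFun s t n (k - 1) ((k - 2) / 2))
        < G.copyCount (completeBipartiteGraph (Fin s) (Fin t)) →
      (SimpleGraph.pathGraph k).IsContained G) ∧
    -- sharpness: both extremal graphs satisfy the assumptions on `G`, attain their value of
    -- the bound, and contain no path on `k` vertices
    (r ≤ (k - 2) / 2 → ∀ a : ℕ, a = r ∨ a = (k - 2) / 2 →
      Fintype.card (Fin a ⊕ Fin (n - (k - 1) + a) ⊕ Fin (k - 1 - 2 * a)) = n ∧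
      (extremalGraph n (k - 1) a).Connected ∧
      r ≤ (extremalGraph n (k - 1) a).minDegree ∧
      (extremalGraph n (k - 1) a).copyCount (completeBipartiteGraph (Fin s) (Fin t))
        = gFun s t n (k - 1) a ∧
      (SimpleGraph.pathGraph k).Free (extremalGraph n (k - 1) a)) := by
  constructor
  · intro V _ G _ hV hconn hdeg hlt
    by_contra hfree
    subst hV
    refine absurd hlt (not_lt.2 (copyCount_completeBipartiteGraph_le hk hs ht hconn hn hdeg
      fun l hl => ?_))
    by_contra! hkl
    exact hfree (pathGraph_isContained_of_isPathList hl hkl)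
  · intro hrh a ha
    have ha1 : 1 ≤ a := by omega
    have ha2 : 2 * a < k - 1 := by omega
    refine ⟨extremalGraph_card (by omega) (by omega), extremalGraph_connected ha1,
      le_trans (by omega) (extremalGraph_le_minDegree ha1),
      extremalGraph_copyCount hs ht (by omega) (by omega), fun hcon => ?_⟩
    obtain ⟨l, hl, hlk⟩ := exists_isPathList_of_pathGraph_isContained hcon
    have := length_le_of_isPathList_extremalGraph ha2 hl
    omega
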